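/- Let $n\ge 1$. A compact body $\Omega\subset\mathbb{R}^n$ is a non-empty compact $n$-dimensional submanifold of $\mathbb{R}^n$ with smooth boundary $\partial\Omega$ (not necessarily connected). Let $B_\Omega$ be the meromorphic function on $\mathbb{C}$ obtained by analytic continuation of $$z\mapsto\iint_{\Omega\times\Omega}|x-y|^z\,dx\,dy \qquad(\operatorname{Re} z>-n),$$ and let $B_{\partial\Omega}$ be the meromorphic function on $\mathbb{C}$ obtained by analytic continuation of $$z\mapsto\iint_{\partial\Omega\times\partial\Omega}|x-y|^z\,dv(x)\,dv(y)\qquad(\operatorname{Re} z>-(n-1)),$$ where $|\cdot|$ is the Euclidean norm and $dv$ is the $(n-1)$-dimensional volume measure of $\partial\Omega$ (counting measure if $n=1$). Their possible poles lie in $P=\{-n,-n-1,-n-3,-n-5,\dots\}$ and $Q=\{-n+1,-n-1,-n-3,\dots\}$ respectively. (1) There is no pair of functions $f\colon\mathbb{C}\to\mathbb{C}$ and $g\colon\mathbb{C}\setminus P\to\mathbb{C}\setminus Q$ such that $f(B_\Omega(z))=B_{\partial\Omega}(g(z))$ for every $z\in\mathbb{C}\setminus P$ and every compact body $\Omega$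 in $\mathbb{R}^n$. (2) There is no pair of functions $\hat f\colon\mathbb{C}\to\mathbb{C}$ and $\hat g\colon\mathbb{C}\setminus Q\to\mathbb{C}\setminus P$ such that $\hat f(B_{\partial\Omega}(z))=B_\Omega(\hat g(z))$ for every $z\in\mathbb{C}\setminus Q$ and every compact body $\Omega$ in $\mathbb{R}^n$. In this sense $B_\Omega$ and $B_{\partial\Omega}$ are functionally independent. -/

import Mathlib

open MeasureTheory
open scoped ContDiff

/-- A *compact body* in `ℝⁿ`: a non-empty compact `n`-dimensional submanifold with smooth boundary.
Near every boundary point it is the sublevel set `{φ ≤ 0}` of a smooth function `φ` whose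
differential does not vanish at that point. It need not be connected. -/
structure IsCompactBody {n : ℕ} (Ω : Set (EuclideanSpace ℝ (Fin n))) : Prop where
  isCompact : IsCompact Ω
  nonempty : Ω.Nonempty
  smooth_boundary : ∀ p ∈ frontier Ω,
    ∃ (U : Set (EuclideanSpace ℝ (Fin n))) (φ : EuclideanSpace ℝ (Fin n) → ℝ),
      IsOpen U ∧ p ∈ U ∧ ContDiffOn ℝ ∞ φ U ∧ fderiv ℝ φ p ≠ 0 ∧
        ∀ x ∈ U, x ∈ Ω ↔ φ x ≤ 0

/-- The Riesz energy `∬ |x - y| ^ z dμ(x) dμ(y)` of a measure `μ` on `ℝⁿ`. -/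
noncomputable def rieszEnergy {n : ℕ} (μ : Measure (EuclideanSpace ℝ (Fin n))) (z : ℂ) : ℂ :=
  ∫ x, ∫ y, ((‖x - y‖ : ℝ) : ℂ) ^ z ∂μ ∂μ

/-- `B` is the meromorphic function on all of `ℂ` extending the Riesz energy of `μ` from the
half-plane `Re z > -m`. (Normal form only fixes the values at singularities: `B` is analytic
wherever the singularity is removable, and has the default value `0` at genuine poles.) -/
def IsMeromorphicEnergy {n : ℕ} (m : ℕ) (μ : Measure (EuclideanSpace ℝ (Fin n))) (B : ℂ → ℂ) :
    Prop :=
  MeromorphicNFOn B Set.univ ∧ ∀ z : ℂ, -(m : ℝ) < z.re → B z = rieszEnergy μ z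

/-- The meromorphic extension is unique. -/
theorem IsMeromorphicEnergy.unique {n m : ℕ} {μ : Measure (EuclideanSpace ℝ (Fin n))}
    {B B' : ℂ → ℂ} (h : IsMeromorphicEnergy m μ B) (h' : IsMeromorphicEnergy m μ B') :
    B = B' := by
  have hm : MeromorphicOn (B - B') Set.univ := h.1.meromorphicOn.sub h'.1.meromorphicOn
  have hopen : IsOpen {z : ℂ | -(m : ℝ) < z.re} := isOpen_lt continuous_const Complex.continuous_re
  have h1 : meromorphicOrderAt (B - B') 1 = ⊤ := by
    rw [meromorphicOrderAt_eq_top_iff]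
    have h1m : (1 : ℂ) ∈ {z : ℂ | -(m : ℝ) < z.re} := by
      have : (0 : ℝ) ≤ m := m.cast_nonneg
      simp only [Set.mem_ofPred_eq, Complex.one_re]
      linarith
    filter_upwards [nhdsWithin_le_nhds (hopen.mem_nhds h1m)] with z hz
    simp [h.2 z hz, h'.2 z hz]
  funext z
  have hz : meromorphicOrderAt (B - B') z = ⊤ := by
    by_contra hne
    exact hm.meromorphicOrderAt_ne_top_of_isPreconnected isPreconnected_univ
      (Set.mem_univ z) (Set.mem_univ 1) hne h1
  rw [meromorphicOrderAt_eq_top_iff] at hz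
  have he : B =ᶠ[nhdsWithin z {z}ᶜ] B' := by
    filter_upwards [hz] with w hw
    exact sub_eq_zero.mp hw
  exact ((h.1 (Set.mem_univ z)).eventuallyEq_nhdsNE_iff_eventuallyEq_nhds
    (h'.1 (Set.mem_univ z))).1 he |>.eq_of_nhds

open Classical in
/-- The meromorphic energy function of an `m`-dimensional measure `μ`: the meromorphic extension
of its Riesz energy from the half-plane `Re z > -m`. -/
noncomputable def meromorphicEnergy {n : ℕ} (m : ℕ) (μ : Measure (EuclideanSpace ℝ (Fin n))) :
    ℂ → ℂ :=
  if h : ∃ B, IsMeromorphicEnergy m μ B then h.choose else 0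

theorem IsMeromorphicEnergy.meromorphicEnergy_eq {n m : ℕ}
    {μ : Measure (EuclideanSpace ℝ (Fin n))} {B : ℂ → ℂ} (h : IsMeromorphicEnergy m μ B) :
    meromorphicEnergy m μ = B := by
  have hex : ∃ B, IsMeromorphicEnergy m μ B := ⟨B, h⟩
  rw [meromorphicEnergy, dif_pos hex]
  exact hex.choose_spec.unique h

/-- `B_Ω`: the meromorphic energy function of a compact body `Ω` in `ℝⁿ`, with respect to the
Lebesgue measure. -/
noncomputable def bodyEnergy {n : ℕ} (Ω : Set (EuclideanSpace ℝ (Fin n))) : ℂ → ℂ :=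
  meromorphicEnergy n (volume.restrict Ω)

/-- `B_{∂Ω}`: the meromorphic energy function of the closed hypersurface `∂Ω`, with respect to the
`(n - 1)`-dimensional volume measure on `∂Ω` (Hausdorff measure normalised as in `ℝⁿ⁻¹`). Only used
for `n ≥ 1`. -/
noncomputable def boundaryEnergy {n : ℕ} (Ω : Set (EuclideanSpace ℝ (Fin n))) : ℂ → ℂ :=
  meromorphicEnergy (n - 1) ((Measure.euclideanHausdorffMeasure (n - 1)).restrict (frontier Ω))

/-- The set `{-n, -n-1, -n-3, -n-5, …}` of possible poles of `B_Ω`. -/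
def bodyPoles (n : ℕ) : Set ℂ :=
  {z | z = -(n : ℂ) ∨ ∃ j : ℕ, z = -(n : ℂ) - 1 - 2 * (j : ℂ)}

/-- The set `{-n+1, -n-1, -n-3, …}` of possible poles of `B_{∂Ω}`. -/
def boundaryPoles (n : ℕ) : Set ℂ :=
  {z | ∃ j : ℕ, z = -(n : ℂ) + 1 - 2 * (j : ℂ)}

/-! ### Continuation of Riesz energies under dilations, disjoint unions and limits -/

section RieszContinuation

open Filter Topology ProbabilityTheory
open scoped NNReal ENNReal

/-! Such a pair (f, g), evaluated at one fixed `z`, says that the value of one energy at `z`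
determines the value of the other at `w = g z`. This is refuted with single balls and disjoint pairs
of equal balls.

At `z = 0` the energy of a measure of positive dimension is its total mass squared. Pairs of unit
balls at varying separation all have the same mass, so the other energy at `w` must not depend on
the separation. The self-energies do not, hence the interaction term would be constant. By
homogeneity the interaction of two balls of radius R at distance 1 is then `K * R ^ w`, and it tends
to the nonzero mass squared as R tends to 0; this forces `w = 0` (`eq_zero_of_energy_determined`).
At `w = 0` volume would determine area, or conversely. One ball of radius R with `R ^ d = 2` has the
same d-dimensional mass as two unit balls, but a different d'-dimensional mass when `d ≠ d'`
(`not_energy_determined`).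

Dimension 1 is special, since 0 lies in Q. In (1) the conclusion `w = 0` is already absurd. In (2)
the point `z = 1` is used: the boundary energy of two intervals of radius R at distance 1 - R is
constantly 8, and letting R tend to 0 contradicts constancy of the body energy
(`not_boundaryEnergy_determines_bodyEnergy_one`).

The point `w` may lie far outside the half-plane of convergence, so the continuation must be known
to exist and to be analytic off P or Q. For the unit ball and the unit sphere it is explicit: the
law of the distance between two random points turns the energy into a Beta integral, that is, into
Gamma factors (`exists_hasContinuation_closedBall`, `exists_hasContinuation_sphere`). Dilation
multiplies by a power of R, and the interaction of disjoint pieces is entire, so the continuation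
passes to all single balls and pairs. -/

theorem Real.rpow_le_rpow_abs_of_inv_le {D r : ℝ} (hD : 1 ≤ D) (h1 : D⁻¹ ≤ r) (h2 : r ≤ D)
    (x : ℝ) : r ^ x ≤ D ^ |x| := by
  have hD0 : 0 < D := by linarith
  have hr : 0 < r := lt_of_lt_of_le (inv_pos.2 hD0) h1
  rcases le_total 0 x with hx | hx
  · rw [abs_of_nonneg hx]
    exact Real.rpow_le_rpow hr.le h2 hx
  · rw [abs_of_nonpos hx, Real.rpow_neg hD0.le, ← Real.inv_rpow hD0.le]
    exact Real.rpow_le_rpow_of_nonpos (inv_pos.2 hD0) h1 hx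

theorem norm_ofReal_cpow_le {D r : ℝ} (hD : 1 ≤ D) (h1 : D⁻¹ ≤ r) (h2 : r ≤ D) (w : ℂ) :
    ‖(r : ℂ) ^ w‖ ≤ D ^ |w.re| := by
  have hr : 0 < r := lt_of_lt_of_le (inv_pos.2 (by linarith)) h1
  rw [Complex.norm_cpow_eq_rpow_re_of_pos hr]
  exact Real.rpow_le_rpow_abs_of_inv_le hD h1 h2 _

theorem integrable_ofReal_cpow {X : Type*} [MeasurableSpace X] {P : Measure X} [IsFiniteMeasure P]
    {r : X → ℝ} (hr : Measurable r) {D : ℝ} (hD : 1 ≤ D) (h : ∀ᵐ x ∂P, D⁻¹ ≤ r x ∧ r x ≤ D)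
    (w : ℂ) : Integrable (fun x => (r x : ℂ) ^ w) P := by
  refine Integrable.of_bound (C := D ^ |w.re|) ?_ ?_
  · exact (Measurable.pow_const (Complex.measurable_ofReal.comp hr) w).aestronglyMeasurable
  · filter_upwards [h] with x hx
    exact norm_ofReal_cpow_le hD hx.1 hx.2 w

/-- The integral is the complex moment generating function of `log r`. As `log r` is bounded almost
everywhere, all exponential moments are finite and the function is entire. -/
theorem analyticAt_integral_ofReal_cpow {X : Type*} [MeasurableSpace X] {P : Measure X}
    [IsFiniteMeasure P] {r : X → ℝ} (hr : Measurable r) {D : ℝ} (hD : 1 ≤ D)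
    (h : ∀ᵐ x ∂P, D⁻¹ ≤ r x ∧ r x ≤ D) (w : ℂ) :
    AnalyticAt ℂ (fun w => ∫ x, (r x : ℂ) ^ w ∂P) w := by
  have hpos : ∀ᵐ x ∂P, 0 < r x := by
    filter_upwards [h] with x hx
    exact lt_of_lt_of_le (inv_pos.2 (by linarith)) hx.1
  have heq : (fun w => ∫ x, (r x : ℂ) ^ w ∂P) = complexMGF (fun x => Real.log (r x)) P := by
    funext z
    refine integral_congr_ae ?_
    filter_upwards [hpos] with x hx
    rw [Complex.cpow_def_of_ne_zero (by exact_mod_cast hx.ne'), ← Complex.ofReal_log hx.le,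
      mul_comm]
  have hset : integrableExpSet (fun x => Real.log (r x)) P = Set.univ := by
    refine Set.eq_univ_of_forall fun t => ?_
    change Integrable _ P
    refine Integrable.of_bound (C := D ^ |t|) ?_ ?_
    · exact (Real.measurable_exp.comp
        ((Real.measurable_log.comp hr).const_mul t)).aestronglyMeasurable
    · filter_upwards [h, hpos] with x hx hx0
      rw [Real.norm_eq_abs, Real.abs_exp, mul_comm, ← Real.rpow_def_of_pos hx0]
      exact Real.rpow_le_rpow_abs_of_inv_le hD hx.1 hx.2 _
  rw [heq]
  refine analyticAt_complexMGF ?_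
  rw [hset]
  simp

/-- `A` is a meromorphic function on `ℂ` that continues the Riesz energy of `μ` from the
half-plane `Re w > -m`, on which the energy integral converges absolutely. -/
structure HasContinuation {n : ℕ} (m : ℕ) (μ : Measure (EuclideanSpace ℝ (Fin n))) (A : ℂ → ℂ) :
    Prop where
  meromorphicOn : MeromorphicOn A Set.univ
  analyticAt : ∀ w : ℂ, -(m : ℝ) < w.re → AnalyticAt ℂ A w
  integrable : ∀ w : ℂ, -(m : ℝ) < w.re →
    Integrable (fun p : EuclideanSpace ℝ (Fin n) × EuclideanSpace ℝ (Fin n) =>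
      ((‖p.1 - p.2‖ : ℝ) : ℂ) ^ w) (μ.prod μ)
  eq_integral : ∀ w : ℂ, -(m : ℝ) < w.re →
    A w = ∫ p : EuclideanSpace ℝ (Fin n) × EuclideanSpace ℝ (Fin n),
      ((‖p.1 - p.2‖ : ℝ) : ℂ) ^ w ∂(μ.prod μ)

variable {n m : ℕ} {μ ν : Measure (EuclideanSpace ℝ (Fin n))} {A B : ℂ → ℂ}

theorem toMeromorphicNFOn_eq_of_analyticAt (hA : MeromorphicOn A Set.univ) {w : ℂ}
    (h : AnalyticAt ℂ A w) : toMeromorphicNFOn A Set.univ w = A w := by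
  rw [toMeromorphicNFOn_eq_toMeromorphicNFAt hA (Set.mem_univ w),
    toMeromorphicNFAt_eq_self.2 h.meromorphicNFAt]

/-- Passing to normal form does not change the value at a point of analyticity, so an explicit
formula with arbitrary values at its poles suffices. Absolute convergence turns the integral over
the product into the iterated integral of `rieszEnergy`. -/
theorem HasContinuation.isMeromorphicEnergy [IsFiniteMeasure μ] (h : HasContinuation m μ A) :
    IsMeromorphicEnergy m μ (toMeromorphicNFOn A Set.univ) := by
  refine ⟨meromorphicNFOn_toMeromorphicNFOn _ _, fun z hz => ?_⟩
  rw [toMeromorphicNFOn_eq_of_analyticAt h.meromorphicOn (h.analyticAt z hz), h.eq_integral z hz,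
    integral_prod _ (h.integrable z hz)]
  rfl

theorem HasContinuation.meromorphicEnergy_eq [IsFiniteMeasure μ] (h : HasContinuation m μ A)
    {w : ℂ} (hw : AnalyticAt ℂ A w) : meromorphicEnergy m μ w = A w := by
  rw [h.isMeromorphicEnergy.meromorphicEnergy_eq,
    toMeromorphicNFOn_eq_of_analyticAt h.meromorphicOn hw]

theorem measurable_riesz_kernel (w : ℂ) :
    Measurable (fun p : EuclideanSpace ℝ (Fin n) × EuclideanSpace ℝ (Fin n) =>
      ((‖p.1 - p.2‖ : ℝ) : ℂ) ^ w) :=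
  Measurable.pow_const (by fun_prop) w

theorem analyticAt_ofReal_const_cpow {R : ℝ} (hR : 0 < R) (w : ℂ) :
    AnalyticAt ℂ (fun w : ℂ => (R : ℂ) ^ w) w := by
  have : (R : ℂ) ∈ Complex.slitPlane := Complex.ofReal_mem_slitPlane.2 hR
  fun_prop (disch := assumption)

theorem prod_smul_map_eq [IsFiniteMeasure μ] [IsFiniteMeasure ν]
    {f g : EuclideanSpace ℝ (Fin n) → EuclideanSpace ℝ (Fin n)} (hf : Measurable f)
    (hg : Measurable g) (k : ℝ≥0) :
    (k • μ.map f).prod (k • ν.map g) = (k ^ 2) • (μ.prod ν).map (Prod.map f g) := by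
  rw [← Measure.map_prod_map _ _ hf hg]
  simp only [Measure.prod_smul_left, Measure.prod_smul_right, smul_smul, sq]

/-- Distances are multiplied by R, and the density k enters once for each of the two points. For
d-dimensional Hausdorff measure it is applied with `k = R ^ d`. -/
theorem HasContinuation.smul_map [IsFiniteMeasure μ] (h : HasContinuation m μ A) (k : ℝ≥0) {R : ℝ}
    (hR : 0 < R) (c : EuclideanSpace ℝ (Fin n)) :
    HasContinuation m (k • μ.map (fun x => R • x + c))
      (fun w => (k : ℂ) ^ 2 * (R : ℂ) ^ w * A w) := by
  have hmeas : Measurable (fun x : EuclideanSpace ℝ (Fin n) => R • x + c) := by fun_prop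
  have hk : ∀ (w : ℂ) (p : EuclideanSpace ℝ (Fin n) × EuclideanSpace ℝ (Fin n)),
      ((‖(Prod.map (fun x => R • x + c) (fun x => R • x + c) p).1 -
        (Prod.map (fun x => R • x + c) (fun x => R • x + c) p).2‖ : ℝ) : ℂ) ^ w =
        (R : ℂ) ^ w * ((‖p.1 - p.2‖ : ℝ) : ℂ) ^ w := by
    intro w p
    simp only [Prod.map_fst, Prod.map_snd, add_sub_add_right_eq_sub, ← smul_sub, norm_smul,
      Real.norm_eq_abs, abs_of_pos hR]
    rw [Complex.ofReal_mul, Complex.mul_cpow_ofReal_nonneg hR.le (norm_nonneg _)]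
  refine ⟨?_, ?_, ?_, ?_⟩
  · intro w hw
    exact (((analyticAt_const).mul (analyticAt_ofReal_const_cpow hR w)).meromorphicAt).mul
      (h.meromorphicOn w hw)
  · intro w hw
    exact (analyticAt_const.mul (analyticAt_ofReal_const_cpow hR w)).mul (h.analyticAt w hw)
  · intro w hw
    rw [prod_smul_map_eq hmeas hmeas]
    refine Integrable.smul_measure_nnreal ?_
    rw [integrable_map_measure (measurable_riesz_kernel w).aestronglyMeasurable
      (hmeas.prodMap hmeas).aemeasurable]
    simp only [Function.comp_def, hk]
    exact (h.integrable w hw).const_mul _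
  · intro w hw
    rw [prod_smul_map_eq hmeas hmeas, integral_smul_nnreal_measure,
      integral_map (hmeas.prodMap hmeas).aemeasurable
        (measurable_riesz_kernel w).aestronglyMeasurable]
    simp only [hk]
    rw [integral_const_mul, ← h.eq_integral w hw, NNReal.smul_def, Complex.real_smul]
    push_cast
    ring

/-- The two cross terms agree by symmetry and are entire, because the distance between the two
pieces is bounded away from 0 and from infinity. All singularities come from the self-energies. -/
theorem HasContinuation.add [IsFiniteMeasure μ] [IsFiniteMeasure ν] (hμ : HasContinuation m μ A)
    (hν : HasContinuation m ν B) {D : ℝ} (hD : 1 ≤ D)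
    (h : ∀ᵐ p ∂(μ.prod ν), D⁻¹ ≤ ‖p.1 - p.2‖ ∧ ‖p.1 - p.2‖ ≤ D) :
    HasContinuation m (μ + ν) (fun w => A w + B w + 2 * ∫ p, ((‖p.1 - p.2‖ : ℝ) : ℂ) ^ w
      ∂(μ.prod ν)) := by
  have hr : Measurable (fun p : EuclideanSpace ℝ (Fin n) × EuclideanSpace ℝ (Fin n) =>
      ‖p.1 - p.2‖) := by fun_prop
  have hX := analyticAt_integral_ofReal_cpow hr hD h
  have hI := integrable_ofReal_cpow hr hD h
  have hI' : ∀ w : ℂ, Integrable (fun p : EuclideanSpace ℝ (Fin n) × EuclideanSpace ℝ (Fin n) =>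
      ((‖p.1 - p.2‖ : ℝ) : ℂ) ^ w) (ν.prod μ) := by
    intro w
    have := (hI w).swap
    refine this.congr (Eventually.of_forall fun p => ?_)
    simp [norm_sub_rev]
  have hsw : ∀ w : ℂ, ∫ p, ((‖p.1 - p.2‖ : ℝ) : ℂ) ^ w ∂(ν.prod μ) =
      ∫ p, ((‖p.1 - p.2‖ : ℝ) : ℂ) ^ w ∂(μ.prod ν) := by
    intro w
    rw [← integral_prod_swap]
    simp [norm_sub_rev]
  have hprod : (μ + ν).prod (μ + ν) = (μ.prod μ + ν.prod μ) + (μ.prod ν + ν.prod ν) := by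
    rw [Measure.prod_add, Measure.add_prod, Measure.add_prod]
  refine ⟨?_, ?_, ?_, ?_⟩
  · intro w hw
    exact ((hμ.meromorphicOn w hw).add (hν.meromorphicOn w hw)).add
      (analyticAt_const.mul (hX w)).meromorphicAt
  · intro w hw
    exact ((hμ.analyticAt w hw).add (hν.analyticAt w hw)).add (analyticAt_const.mul (hX w))
  · intro w hw
    rw [hprod]
    exact ((hμ.integrable w hw).add_measure (hI' w)).add_measure
      ((hI w).add_measure (hν.integrable w hw))
  · intro w hw
    rw [hprod, integral_add_measure ((hμ.integrable w hw).add_measure (hI' w))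
      ((hI w).add_measure (hν.integrable w hw)), integral_add_measure (hμ.integrable w hw) (hI' w),
      integral_add_measure (hI w) (hν.integrable w hw), hsw, ← hμ.eq_integral w hw,
      ← hν.eq_integral w hw]
    ring

/-- The interaction energy of a copy of `μ` scaled by `R` with its translate by `c`. -/
noncomputable def interaction (μ : Measure (EuclideanSpace ℝ (Fin n))) (R : ℝ)
    (c : EuclideanSpace ℝ (Fin n)) (w : ℂ) : ℂ :=
  ∫ p, ((‖R • (p.1 - p.2) - c‖ : ℝ) : ℂ) ^ w ∂(μ.prod μ)

/-- Homogeneity trades a large separation of fixed balls for a small radius at fixed separation. -/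
theorem interaction_smul {t : ℝ} (ht : 0 < t) (R : ℝ) (c : EuclideanSpace ℝ (Fin n)) (w : ℂ) :
    interaction μ (t * R) (t • c) w = (t : ℂ) ^ w * interaction μ R c w := by
  rw [interaction, interaction, ← integral_const_mul]
  congr 1
  funext p
  rw [mul_smul, ← smul_sub, norm_smul, Real.norm_eq_abs, abs_of_pos ht, Complex.ofReal_mul,
    Complex.mul_cpow_ofReal_nonneg ht.le (norm_nonneg _)]

theorem ae_norm_le_one_prod [IsFiniteMeasure μ] (hμ : ∀ᵐ x ∂μ, ‖x‖ ≤ 1) :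
    ∀ᵐ p ∂(μ.prod μ), ‖p.1 - p.2‖ ≤ 2 := by
  filter_upwards [Measure.quasiMeasurePreserving_fst.ae hμ,
    Measure.quasiMeasurePreserving_snd.ae hμ] with p h1 h2
  linarith [norm_sub_le p.1 p.2]

theorem HasContinuation.pair [IsFiniteMeasure μ] (h : HasContinuation m μ A)
    (hμ : ∀ᵐ x ∂μ, ‖x‖ ≤ 1) (k : ℝ≥0) {R : ℝ} (hR : 0 < R) {c : EuclideanSpace ℝ (Fin n)}
    (hc : 2 * R < ‖c‖) :
    HasContinuation m (k • μ.map (fun x => R • x) + k • μ.map (fun x => R • x + c))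
      (fun w => 2 * (k : ℂ) ^ 2 * ((R : ℂ) ^ w * A w + interaction μ R c w)) := by
  have h1 := h.smul_map k hR 0
  have h2 := h.smul_map k hR c
  simp only [add_zero] at h1
  have hm1 : Measurable (fun x : EuclideanSpace ℝ (Fin n) => R • x) := by fun_prop
  have hm2 : Measurable (fun x : EuclideanSpace ℝ (Fin n) => R • x + c) := by fun_prop
  have hr : ∀ p : EuclideanSpace ℝ (Fin n) × EuclideanSpace ℝ (Fin n),
      (Prod.map (fun x => R • x) (fun x => R • x + c) p).1 -
      (Prod.map (fun x => R • x) (fun x => R • x + c) p).2 = R • (p.1 - p.2) - c := by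
    intro p
    simp only [Prod.map_fst, Prod.map_snd, smul_sub]
    abel
  obtain ⟨D, hD1, hD2, hD3⟩ : ∃ D : ℝ, 1 ≤ D ∧ D⁻¹ ≤ ‖c‖ - 2 * R ∧ 2 * R + ‖c‖ ≤ D := by
    refine ⟨max (max 1 (‖c‖ - 2 * R)⁻¹) (2 * R + ‖c‖), ?_, ?_, le_max_right _ _⟩
    · exact le_max_of_le_left (le_max_left _ _)
    · exact inv_le_of_inv_le₀ (by linarith) (le_max_of_le_left (le_max_right _ _))
  have hae : ∀ᵐ p ∂((k • μ.map (fun x => R • x)).prod (k • μ.map (fun x => R • x + c))),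
      D⁻¹ ≤ ‖p.1 - p.2‖ ∧ ‖p.1 - p.2‖ ≤ D := by
    rw [prod_smul_map_eq hm1 hm2]
    refine Measure.ae_smul_measure ?_ _
    rw [ae_map_iff (hm1.prodMap hm2).aemeasurable]
    · filter_upwards [ae_norm_le_one_prod hμ] with p hp
      rw [hr]
      have h3 : ‖R • (p.1 - p.2)‖ ≤ 2 * R := by
        rw [norm_smul, Real.norm_eq_abs, abs_of_pos hR]
        nlinarith
      have h4 := norm_sub_norm_le c (R • (p.1 - p.2))
      have h5 := norm_sub_le (R • (p.1 - p.2)) c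
      rw [norm_sub_rev] at h4
      constructor <;> linarith
    · exact (by fun_prop : Measurable fun p : EuclideanSpace ℝ (Fin n) ×
        EuclideanSpace ℝ (Fin n) => ‖p.1 - p.2‖) measurableSet_Icc
  convert h1.add h2 hD1 hae using 1
  funext w
  rw [prod_smul_map_eq hm1 hm2, integral_smul_nnreal_measure,
      integral_map (hm1.prodMap hm2).aemeasurable (measurable_riesz_kernel w).aestronglyMeasurable]
  simp only [hr]
  rw [NNReal.smul_def, Complex.real_smul, interaction]
  push_cast
  ring

theorem analyticAt_interaction [IsFiniteMeasure μ] (hμ : ∀ᵐ x ∂μ, ‖x‖ ≤ 1) {R : ℝ} (hR : 0 < R)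
    {c : EuclideanSpace ℝ (Fin n)} (hc : 2 * R < ‖c‖) (w : ℂ) :
    AnalyticAt ℂ (interaction μ R c) w := by
  obtain ⟨D, hD1, hD2, hD3⟩ : ∃ D : ℝ, 1 ≤ D ∧ D⁻¹ ≤ ‖c‖ - 2 * R ∧ 2 * R + ‖c‖ ≤ D := by
    refine ⟨max (max 1 (‖c‖ - 2 * R)⁻¹) (2 * R + ‖c‖), ?_, ?_, le_max_right _ _⟩
    · exact le_max_of_le_left (le_max_left _ _)
    · exact inv_le_of_inv_le₀ (by linarith) (le_max_of_le_left (le_max_right _ _))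
  refine analyticAt_integral_ofReal_cpow
    (r := fun p : EuclideanSpace ℝ (Fin n) × EuclideanSpace ℝ (Fin n) => ‖R • (p.1 - p.2) - c‖)
    (by fun_prop) hD1 ?_ w
  filter_upwards [ae_norm_le_one_prod hμ] with p hp
  have h3 : ‖R • (p.1 - p.2)‖ ≤ 2 * R := by
    rw [norm_smul, Real.norm_eq_abs, abs_of_pos hR]
    nlinarith
  have h4 := norm_sub_norm_le c (R • (p.1 - p.2))
  have h5 := norm_sub_le (R • (p.1 - p.2)) c
  rw [norm_sub_rev] at h4
  constructor <;> linarith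

theorem HasContinuation.meromorphicEnergy_pair [IsFiniteMeasure μ] (h : HasContinuation m μ A)
    (hμ : ∀ᵐ x ∂μ, ‖x‖ ≤ 1) (k : ℝ≥0) {R : ℝ} (hR : 0 < R) {c : EuclideanSpace ℝ (Fin n)}
    (hc : 2 * R < ‖c‖) {w : ℂ} (hw : AnalyticAt ℂ A w) :
    meromorphicEnergy m (k • μ.map (fun x => R • x) + k • μ.map (fun x => R • x + c)) w =
      2 * (k : ℂ) ^ 2 * ((R : ℂ) ^ w * A w + interaction μ R c w) :=
  (h.pair hμ k hR hc).meromorphicEnergy_eq (analyticAt_const.mul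
    (((analyticAt_ofReal_const_cpow hR w).mul hw).add (analyticAt_interaction hμ hR hc w)))

/-- Shrinking balls at separation tending to 1 look like two point masses at distance 1, where the
kernel equals 1. -/
theorem tendsto_interaction [IsFiniteMeasure μ] (hμ : ∀ᵐ x ∂μ, ‖x‖ ≤ 1) {ι : Type*}
    {l : Filter ι} [l.IsCountablyGenerated] {t s : ι → ℝ} (ht : Tendsto t l (𝓝 0))
    (hs : Tendsto s l (𝓝 1)) {e : EuclideanSpace ℝ (Fin n)} (he : ‖e‖ = 1) (w : ℂ) :
    Tendsto (fun i => interaction μ (t i) (s i • e) w) l (𝓝 ((μ.real Set.univ : ℂ) ^ 2)) := by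
  have hlim : ((μ.real Set.univ : ℂ) ^ 2) =
      ∫ p : EuclideanSpace ℝ (Fin n) × EuclideanSpace ℝ (Fin n), (1 : ℂ) ∂(μ.prod μ) := by
    simp [← Set.univ_prod_univ, measureReal_prod_prod, sq]
  rw [hlim]
  refine tendsto_integral_filter_of_dominated_convergence (fun _ => 2 ^ |w.re|) ?_ ?_ ?_ ?_
  · refine Eventually.of_forall fun i => Measurable.aestronglyMeasurable ?_
    exact Measurable.pow_const (by fun_prop) w
  · have h1 : ∀ᶠ i in l, |t i| < 1 / 8 := by
      have := ht.abs
      rw [abs_zero] at this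
      exact this.eventually (gt_mem_nhds (by norm_num))
    have h2 : ∀ᶠ i in l, s i ∈ Set.Ioo (3 / 4 : ℝ) (5 / 4) :=
      hs.eventually (Ioo_mem_nhds (by norm_num) (by norm_num))
    filter_upwards [h1, h2] with i hi1 hi2
    filter_upwards [ae_norm_le_one_prod hμ] with p hp
    have h3 : ‖t i • (p.1 - p.2)‖ ≤ 1 / 4 := by
      rw [norm_smul, Real.norm_eq_abs]
      nlinarith [abs_nonneg (t i), norm_nonneg (p.1 - p.2)]
    have h6 : ‖s i • e‖ = s i := by
      rw [norm_smul, he, Real.norm_eq_abs, abs_of_pos (by linarith [hi2.1]), mul_one]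
    have h4 := norm_sub_norm_le (s i • e) (t i • (p.1 - p.2))
    have h5 := norm_sub_le (t i • (p.1 - p.2)) (s i • e)
    rw [norm_sub_rev] at h4
    refine norm_ofReal_cpow_le one_le_two ?_ ?_ w
    · linarith [hi2.1]
    · linarith [hi2.2]
  · exact integrable_const _
  · refine Eventually.of_forall fun p => ?_
    have h1 : Tendsto (fun i => ‖t i • (p.1 - p.2) - s i • e‖) l (𝓝 1) := by
      have := ((ht.smul_const (p.1 - p.2)).sub (hs.smul_const e)).norm
      simpa [he] using this
    have h2 : ContinuousAt (fun r : ℝ => (r : ℂ) ^ w) 1 :=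
      Complex.continuousAt_ofReal_cpow_const _ _ (Or.inr one_ne_zero)
    have h3 := h2.tendsto.comp h1
    simpa [Function.comp_def] using h3

/-- The limit is unchanged by the substitution of `a * R` for R, which multiplies the function by `a
^ w`; hence `a ^ w = 1` for every positive a. Differentiating `exp (t * w) = 1` at `t = 0` gives `w
= 0`. -/
theorem eq_zero_of_tendsto_cpow {K L w : ℂ} (hL : L ≠ 0)
    (h : Tendsto (fun R : ℝ => K * (R : ℂ) ^ w) (𝓝[>] 0) (𝓝 L)) : w = 0 := by
  have hone : ∀ a : ℝ, 0 < a → (a : ℂ) ^ w = 1 := by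
    intro a ha
    have h1 : Tendsto (fun R : ℝ => a * R) (𝓝[>] 0) (𝓝[>] 0) := by
      refine tendsto_nhdsWithin_iff.2 ⟨?_, ?_⟩
      · have : Tendsto (fun R : ℝ => a * R) (𝓝 0) (𝓝 (a * 0)) := tendsto_id.const_mul a
        rw [mul_zero] at this
        exact this.mono_left nhdsWithin_le_nhds
      · filter_upwards [self_mem_nhdsWithin] with R hR
        exact mul_pos ha hR
    have h2 := h.comp h1
    have h3 := h.const_mul ((a : ℂ) ^ w)
    have h4 : ∀ᶠ R : ℝ in 𝓝[>] 0, ((fun R : ℝ => K * (R : ℂ) ^ w) ∘ fun R : ℝ => a * R) R =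
        (a : ℂ) ^ w * (K * (R : ℂ) ^ w) := by
      filter_upwards [self_mem_nhdsWithin] with R hR
      simp only [Function.comp_apply, Complex.ofReal_mul]
      rw [Complex.mul_cpow_ofReal_nonneg ha.le (le_of_lt hR)]
      ring
    have h5 := tendsto_nhds_unique (h2.congr' h4) h3
    have h6 : ((a : ℂ) ^ w - 1) * L = 0 := by rw [sub_mul, ← h5]; ring
    rcases mul_eq_zero.1 h6 with h7 | h7
    · exact sub_eq_zero.1 h7
    · exact absurd h7 hL
  have hexp : (fun t : ℝ => Complex.exp ((t : ℂ) * w)) = fun _ => 1 := by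
    funext t
    have := hone (Real.exp t) (Real.exp_pos t)
    rwa [Complex.cpow_def_of_ne_zero (by exact_mod_cast (Real.exp_pos t).ne'),
      ← Complex.ofReal_log (Real.exp_pos t).le, Real.log_exp] at this
  have hd : HasDerivAt (fun t : ℝ => Complex.exp ((t : ℂ) * w)) w 0 := by
    have := ((Complex.ofRealCLM.hasDerivAt (x := (0 : ℝ))).mul_const w).cexp
    simpa using this
  rw [hexp] at hd
  exact hd.unique (hasDerivAt_const _ _)

/-- Halving R multiplies `R ^ (-2)` by 4, so the function at R/2 minus 4 times the function at R is
a multiple of `R ^ w` alone. Its limit is -3L, which is nonzero. -/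
theorem not_tendsto_cpow_neg_two_sub {c a L w : ℂ} (hL : L ≠ 0)
    (h : Tendsto (fun R : ℝ => c * (R : ℂ) ^ (-2 : ℂ) - a * (R : ℂ) ^ w) (𝓝[>] 0) (𝓝 L)) :
    w = 0 := by
  have h1 : Tendsto (fun R : ℝ => (2 : ℝ)⁻¹ * R) (𝓝[>] 0) (𝓝[>] 0) := by
    refine tendsto_nhdsWithin_iff.2 ⟨?_, ?_⟩
    · have : Tendsto (fun R : ℝ => (2 : ℝ)⁻¹ * R) (𝓝 0) (𝓝 ((2 : ℝ)⁻¹ * 0)) :=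
        tendsto_id.const_mul _
      rw [mul_zero] at this
      exact this.mono_left nhdsWithin_le_nhds
    · filter_upwards [self_mem_nhdsWithin] with R hR
      exact mul_pos (by norm_num : (0 : ℝ) < 2⁻¹) hR
  have h2 := (h.comp h1).sub (h.const_mul 4)
  refine eq_zero_of_tendsto_cpow (K := a * (4 - ((2 : ℝ)⁻¹ : ℝ) ^ w)) (L := L - 4 * L) ?_ ?_
  · intro h0
    apply hL
    linear_combination (-1 / 3 : ℂ) * h0
  · refine h2.congr' ?_
    filter_upwards [self_mem_nhdsWithin] with R hR
    have hhalf : (0 : ℝ) ≤ (2 : ℝ)⁻¹ := by norm_num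
    simp only [Function.comp_apply, Complex.ofReal_mul]
    rw [Complex.mul_cpow_ofReal_nonneg hhalf (le_of_lt hR),
      Complex.mul_cpow_ofReal_nonneg hhalf (le_of_lt hR)]
    have h4 : ((2⁻¹ : ℝ) : ℂ) ^ (-2 : ℂ) = 4 := by
      rw [Complex.cpow_neg, Complex.cpow_ofNat]
      norm_num
    rw [h4]
    ring

end RieszContinuation

/-! ### Balls and pairs of balls as compact bodies, and scaling of their measures -/

section CompactBodies

open Metric
open scoped NNReal ENNReal Pointwise

variable {n : ℕ}

theorem frontier_union_of_disjoint {X : Type*} [TopologicalSpace X] {s t : Set X}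
    (hs : IsClosed s) (ht : IsClosed t) (h : Disjoint s t) :
    frontier (s ∪ t) = frontier s ∪ frontier t := by
  have hst : Disjoint (closure s) (closure t) := by rwa [hs.closure_eq, ht.closure_eq]
  rw [(hs.union ht).frontier_eq, hs.frontier_eq, ht.frontier_eq,
    interior_union_of_disjoint_closure hst]
  ext x
  have h1 : x ∈ s → x ∉ t := fun hx => Set.disjoint_left.1 h hx
  have h2 : x ∈ interior s → x ∈ s := fun hx => interior_subset hx
  have h3 : x ∈ interior t → x ∈ t := fun hx => interior_subset hx
  simp only [Set.mem_sdiff, Set.mem_union]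
  tauto

theorem isCompactBody_closedBall (c : EuclideanSpace ℝ (Fin n)) {R : ℝ} (hR : 0 < R) :
    IsCompactBody (closedBall c R) := by
  refine ⟨isCompact_closedBall c R, ⟨c, mem_closedBall_self hR.le⟩, fun p hp => ?_⟩
  rw [frontier_closedBall c hR.ne', mem_sphere_iff_norm] at hp
  refine ⟨Set.univ, fun x => ‖x - c‖ ^ 2 - R ^ 2, isOpen_univ, Set.mem_univ p, ?_, ?_, ?_⟩
  · exact (((contDiff_id.sub contDiff_const).norm_sq ℝ).sub contDiff_const).contDiffOn
  · have h1 : HasFDerivAt (fun x => ‖x - c‖ ^ 2 - R ^ 2) _ p :=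
      (((hasFDerivAt_id p).sub_const c).norm_sq).sub_const (R ^ 2)
    intro h0
    -- In the radial direction the derivative equals twice the squared radius, which is nonzero.
    have h2 := congrArg (fun L => L (p - c)) h0
    rw [h1.fderiv] at h2
    simp [← inner_sub_left, sub_eq_zero] at h2
    simp [h2, hR.ne] at hp
  · intro x _
    rw [mem_closedBall_iff_norm, sub_nonpos, sq_le_sq₀ (norm_nonneg _) hR.le]

theorem IsCompactBody.union {s t : Set (EuclideanSpace ℝ (Fin n))} (hs : IsCompactBody s)
    (ht : IsCompactBody t) (h : Disjoint s t) : IsCompactBody (s ∪ t) := by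
  refine ⟨hs.isCompact.union ht.isCompact, hs.nonempty.mono Set.subset_union_left, fun p hp => ?_⟩
  have hsc := hs.isCompact.isClosed
  have htc := ht.isCompact.isClosed
  rw [frontier_union_of_disjoint hsc htc h] at hp
  rcases hp with hp | hp
  · obtain ⟨U, φ, hU, hpU, hφ, hd, hx⟩ := hs.smooth_boundary p hp
    refine ⟨U ∩ tᶜ, φ, hU.inter htc.isOpen_compl, ⟨hpU, ?_⟩, hφ.mono Set.inter_subset_left, hd, ?_⟩
    · exact Set.disjoint_left.1 h (hsc.frontier_subset hp)
    · intro x hxU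
      rw [← hx x hxU.1]
      exact ⟨fun h' => h'.resolve_right hxU.2, Or.inl⟩
  · obtain ⟨U, φ, hU, hpU, hφ, hd, hx⟩ := ht.smooth_boundary p hp
    refine ⟨U ∩ sᶜ, φ, hU.inter hsc.isOpen_compl, ⟨hpU, ?_⟩, hφ.mono Set.inter_subset_left, hd, ?_⟩
    · exact Set.disjoint_right.1 h (htc.frontier_subset hp)
    · intro x hxU
      rw [← hx x hxU.1]
      exact ⟨fun h' => h'.resolve_left hxU.2, Or.inr⟩

/-- Two closed balls of radius `R`, centred at `0` and at `c`. -/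
def ballPair (R : ℝ) (c : EuclideanSpace ℝ (Fin n)) : Set (EuclideanSpace ℝ (Fin n)) :=
  closedBall 0 R ∪ closedBall c R

theorem disjoint_closedBall_zero {R : ℝ} {c : EuclideanSpace ℝ (Fin n)} (hc : 2 * R < ‖c‖) :
    Disjoint (closedBall 0 R) (closedBall c R) := by
  refine closedBall_disjoint_closedBall ?_
  rw [dist_zero_left]
  linarith

theorem isCompactBody_ballPair {R : ℝ} (hR : 0 < R) {c : EuclideanSpace ℝ (Fin n)}
    (hc : 2 * R < ‖c‖) : IsCompactBody (ballPair R c) :=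
  (isCompactBody_closedBall 0 hR).union (isCompactBody_closedBall c hR)
    (disjoint_closedBall_zero hc)

theorem frontier_ballPair {R : ℝ} (hR : 0 < R) {c : EuclideanSpace ℝ (Fin n)}
    (hc : 2 * R < ‖c‖) : frontier (ballPair R c) = sphere 0 R ∪ sphere c R := by
  rw [ballPair, frontier_union_of_disjoint isClosed_closedBall isClosed_closedBall
    (disjoint_closedBall_zero hc), frontier_closedBall _ hR.ne', frontier_closedBall _ hR.ne']

/-- Hausdorff measure of dimension d scales by `R ^ d`. Leaving d free serves both the ball, where d
= n gives Lebesgue measure, and the sphere, where d = n - 1. -/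
theorem restrict_hausdorff_eq_smul_map (d : ℕ) {R : ℝ} (hR : 0 < R) (c : EuclideanSpace ℝ (Fin n))
    {S T : Set (EuclideanSpace ℝ (Fin n))} (h : (fun x => R • x + c) ⁻¹' S = T) :
    (μHE[d] : Measure (EuclideanSpace ℝ (Fin n))).restrict S =
      (R.toNNReal ^ d) • (μHE[d].restrict T).map (fun x => R • x + c) := by
  have hmeas : Measurable (fun x : EuclideanSpace ℝ (Fin n) => R • x + c) := by fun_prop
  have himg : ∀ U : Set (EuclideanSpace ℝ (Fin n)),
      μHE[d] ((fun x => R • x + c) '' U) = (R.toNNReal ^ d) • μHE[d] U := by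
    intro U
    have h1 : (fun x => R • x + c) '' U = (fun x => x + c) '' (R • U) := by
      rw [← Set.image_smul, Set.image_image]
    rw [h1, (isometry_add_right c).euclideanHausdorffMeasure_image,
      Measure.euclideanHausdorffMeasure_smul₀ d hR.ne']
    congr 2
    ext
    simp [abs_of_pos hR, hR.le]
  ext s hs
  rw [Measure.restrict_apply hs, Measure.smul_apply, Measure.map_apply hmeas hs,
    Measure.restrict_apply (hmeas hs), ← himg, ← h, ← Set.preimage_inter,
    Set.image_preimage_eq]
  intro y
  refine ⟨R⁻¹ • (y - c), ?_⟩
  simp [smul_smul, hR.ne']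

theorem preimage_closedBall (c : EuclideanSpace ℝ (Fin n)) {R : ℝ} (hR : 0 < R) :
    (fun x => R • x + c) ⁻¹' closedBall c R = closedBall 0 1 := by
  ext x
  simp [norm_smul, abs_of_pos hR, hR]

theorem preimage_sphere (c : EuclideanSpace ℝ (Fin n)) {R : ℝ} (hR : 0 < R) :
    (fun x => R • x + c) ⁻¹' sphere c R = sphere 0 1 := by
  ext x
  simp [norm_smul, abs_of_pos hR, hR.ne']

theorem restrict_hausdorff_union (d : ℕ) {R : ℝ} (hR : 0 < R) {c : EuclideanSpace ℝ (Fin n)}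
    {S S' T : Set (EuclideanSpace ℝ (Fin n))} (h : (fun x => R • x) ⁻¹' S = T)
    (h' : (fun x => R • x + c) ⁻¹' S' = T) (hd : Disjoint S S') (hS' : MeasurableSet S') :
    (μHE[d] : Measure (EuclideanSpace ℝ (Fin n))).restrict (S ∪ S') =
      (R.toNNReal ^ d) • (μHE[d].restrict T).map (fun x => R • x) +
      (R.toNNReal ^ d) • (μHE[d].restrict T).map (fun x => R • x + c) := by
  rw [Measure.restrict_union hd hS', restrict_hausdorff_eq_smul_map d hR c h',
    restrict_hausdorff_eq_smul_map d hR 0 (S := S) (T := T) (by simpa using h)]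
  simp only [add_zero]

theorem bodyEnergy_closedBall [IsFiniteMeasure
      (μHE[n].restrict (closedBall (0 : EuclideanSpace ℝ (Fin n)) 1))] {A : ℂ → ℂ}
    (hA : HasContinuation n (μHE[n].restrict (closedBall (0 : EuclideanSpace ℝ (Fin n)) 1)) A)
    {R : ℝ} (hR : 0 < R) {w : ℂ} (hw : AnalyticAt ℂ A w) :
    bodyEnergy (closedBall (0 : EuclideanSpace ℝ (Fin n)) R) w =
      ((R : ℂ) ^ n) ^ 2 * (R : ℂ) ^ w * A w := by
  rw [bodyEnergy, ← EuclideanSpace.euclideanHausdorffMeasure_eq_volume,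
    restrict_hausdorff_eq_smul_map n hR 0 (preimage_closedBall 0 hR),
    (hA.smul_map _ hR 0).meromorphicEnergy_eq
      ((analyticAt_const.mul (analyticAt_ofReal_const_cpow hR w)).mul hw)]
  simp [hR.le]

theorem bodyEnergy_ballPair [IsFiniteMeasure
      (μHE[n].restrict (closedBall (0 : EuclideanSpace ℝ (Fin n)) 1))] {A : ℂ → ℂ}
    (hA : HasContinuation n (μHE[n].restrict (closedBall (0 : EuclideanSpace ℝ (Fin n)) 1)) A)
    {R : ℝ} (hR : 0 < R) {c : EuclideanSpace ℝ (Fin n)} (hc : 2 * R < ‖c‖) {w : ℂ}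
    (hw : AnalyticAt ℂ A w) :
    bodyEnergy (ballPair R c) w = 2 * ((R : ℂ) ^ n) ^ 2 * ((R : ℂ) ^ w * A w +
      interaction (μHE[n].restrict (closedBall (0 : EuclideanSpace ℝ (Fin n)) 1)) R c w) := by
  have h0 := preimage_closedBall (n := n) 0 hR
  simp only [add_zero] at h0
  have hae : ∀ᵐ x ∂(μHE[n].restrict (closedBall (0 : EuclideanSpace ℝ (Fin n)) 1)), ‖x‖ ≤ 1 := by
    filter_upwards [ae_restrict_mem measurableSet_closedBall] with x hx
    simpa using hx
  rw [bodyEnergy, ← EuclideanSpace.euclideanHausdorffMeasure_eq_volume, ballPair,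
    restrict_hausdorff_union n hR h0 (preimage_closedBall c hR) (disjoint_closedBall_zero hc)
      measurableSet_closedBall, hA.meromorphicEnergy_pair hae _ hR hc hw]
  simp [hR.le]

theorem boundaryEnergy_closedBall [IsFiniteMeasure
      (μHE[n - 1].restrict (sphere (0 : EuclideanSpace ℝ (Fin n)) 1))] {A : ℂ → ℂ}
    (hA : HasContinuation (n - 1)
      (μHE[n - 1].restrict (sphere (0 : EuclideanSpace ℝ (Fin n)) 1)) A)
    {R : ℝ} (hR : 0 < R) {w : ℂ} (hw : AnalyticAt ℂ A w) :
    boundaryEnergy (closedBall (0 : EuclideanSpace ℝ (Fin n)) R) w =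
      ((R : ℂ) ^ (n - 1)) ^ 2 * (R : ℂ) ^ w * A w := by
  rw [boundaryEnergy, frontier_closedBall _ hR.ne',
    restrict_hausdorff_eq_smul_map (n - 1) hR 0 (preimage_sphere 0 hR),
    (hA.smul_map _ hR 0).meromorphicEnergy_eq
      ((analyticAt_const.mul (analyticAt_ofReal_const_cpow hR w)).mul hw)]
  simp [hR.le]

theorem boundaryEnergy_ballPair [IsFiniteMeasure
      (μHE[n - 1].restrict (sphere (0 : EuclideanSpace ℝ (Fin n)) 1))] {A : ℂ → ℂ}
    (hA : HasContinuation (n - 1)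
      (μHE[n - 1].restrict (sphere (0 : EuclideanSpace ℝ (Fin n)) 1)) A)
    {R : ℝ} (hR : 0 < R) {c : EuclideanSpace ℝ (Fin n)} (hc : 2 * R < ‖c‖) {w : ℂ}
    (hw : AnalyticAt ℂ A w) :
    boundaryEnergy (ballPair R c) w = 2 * ((R : ℂ) ^ (n - 1)) ^ 2 * ((R : ℂ) ^ w * A w +
      interaction (μHE[n - 1].restrict (sphere (0 : EuclideanSpace ℝ (Fin n)) 1)) R c w) := by
  have h0 := preimage_sphere (n := n) 0 hR
  simp only [add_zero] at h0
  have hae : ∀ᵐ x ∂(μHE[n - 1].restrict (sphere (0 : EuclideanSpace ℝ (Fin n)) 1)), ‖x‖ ≤ 1 := by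
    filter_upwards [ae_restrict_mem isClosed_sphere.measurableSet] with x hx
    exact le_of_eq (by simpa using hx)
  rw [boundaryEnergy, frontier_ballPair hR hc,
    restrict_hausdorff_union (n - 1) hR h0 (preimage_sphere c hR)
      ((disjoint_closedBall_zero hc).mono sphere_subset_closedBall sphere_subset_closedBall)
      isClosed_sphere.measurableSet, hA.meromorphicEnergy_pair hae _ hR hc hw]
  simp [hR.le]

end CompactBodies

/-! ### Slicing along the first axis, polar coordinates and transfer of laws -/

section Slicing

open Metric
open scoped NNReal ENNReal

variable {k : ℕ}

/-- The point of `ℝᵏ⁺¹` with first coordinate `t` and remaining coordinates `v`. -/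
noncomputable def consPoint (t : ℝ) (v : EuclideanSpace ℝ (Fin k)) :
    EuclideanSpace ℝ (Fin (k + 1)) :=
  WithLp.toLp 2 (Fin.cons t v.ofLp)

@[simp]
theorem consPoint_zero (t : ℝ) (v : EuclideanSpace ℝ (Fin k)) : consPoint t v 0 = t := rfl

@[simp]
theorem consPoint_succ (t : ℝ) (v : EuclideanSpace ℝ (Fin k)) (i : Fin k) :
    consPoint t v i.succ = v i := rfl

theorem norm_sq_consPoint (t : ℝ) (v : EuclideanSpace ℝ (Fin k)) :
    ‖consPoint t v‖ ^ 2 = t ^ 2 + ‖v‖ ^ 2 := by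
  simp [EuclideanSpace.real_norm_sq_eq, Fin.sum_univ_succ]

theorem consPoint_add (t s : ℝ) (v w : EuclideanSpace ℝ (Fin k)) :
    consPoint t v + consPoint s w = consPoint (t + s) (v + w) := by
  ext i
  refine Fin.cases ?_ (fun j => ?_) i <;> simp

theorem consPoint_smul (a t : ℝ) (v : EuclideanSpace ℝ (Fin k)) :
    a • consPoint t v = consPoint (a * t) (a • v) := by
  ext i
  refine Fin.cases ?_ (fun j => ?_) i <;> simp

theorem exists_eq_consPoint (x : EuclideanSpace ℝ (Fin (k + 1))) :
    ∃ t v, x = consPoint t v :=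
  ⟨x 0, WithLp.toLp 2 fun i => x i.succ, by
    ext i
    refine Fin.cases ?_ (fun j => ?_) i <;> simp⟩

theorem norm_consPoint_one_zero : ‖(consPoint 1 0 : EuclideanSpace ℝ (Fin (k + 1)))‖ = 1 := by
  have := norm_sq_consPoint (k := k) 1 0
  rw [← sq_eq_sq₀ (norm_nonneg _) zero_le_one, this]
  simp

theorem measurable_consPoint : Measurable
    (fun p : ℝ × EuclideanSpace ℝ (Fin k) => consPoint p.1 p.2) := by
  refine (PiLp.volume_preserving_toLp (Fin (k + 1))).measurable.comp ?_
  refine measurable_pi_lambda _ fun i => ?_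
  refine Fin.cases ?_ (fun j => ?_) i
  · exact measurable_fst
  · simp only [Fin.cons_succ]
    fun_prop

theorem measurePreserving_consPoint : MeasurePreserving
    (fun p : ℝ × EuclideanSpace ℝ (Fin k) => consPoint p.1 p.2) := by
  have h1 := (volume_preserving_piFinSuccAbove (fun _ : Fin (k + 1) => ℝ) 0).symm
  have h2 : MeasurePreserving (Prod.map id (WithLp.ofLp (p := 2)) :
      ℝ × EuclideanSpace ℝ (Fin k) → ℝ × (Fin k → ℝ)) (volume.prod volume) (volume.prod volume) :=
    (MeasurePreserving.id volume).prod (PiLp.volume_preserving_ofLp (Fin k))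
  have h3 := (PiLp.volume_preserving_toLp (Fin (k + 1))).comp (h1.comp h2)
  refine ⟨measurable_consPoint, ?_⟩
  rw [Measure.volume_eq_prod, ← h3.map_eq]
  congr 1
  funext p
  simp only [consPoint, Function.comp_def, MeasurableEquiv.piFinSuccAbove_symm_apply,
    Fin.insertNthEquiv_zero]
  rfl

theorem lintegral_eq_lintegral_consPoint {F : EuclideanSpace ℝ (Fin (k + 1)) → ℝ≥0∞}
    (hF : Measurable F) : ∫⁻ x, F x = ∫⁻ v, ∫⁻ t, F (consPoint t v) := by
  rw [← measurePreserving_consPoint.lintegral_comp hF]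
  exact lintegral_prod_symm _ (hF.comp measurable_consPoint).aemeasurable

/-- Polar coordinates for nonnegative functions, free of integrability conditions; the constant is
the area of the unit sphere. -/
theorem lintegral_fun_norm_euclidean {f : ℝ → ℝ≥0∞} (hf : Measurable f) :
    ∫⁻ x : EuclideanSpace ℝ (Fin (k + 1)), f ‖x‖ =
      ((k + 1 : ℕ) * volume (ball (0 : EuclideanSpace ℝ (Fin (k + 1))) 1)) *
        ∫⁻ r in Set.Ioi (0 : ℝ), ENNReal.ofReal (r ^ k) * f r := by
  have h1 := (volume : Measure (EuclideanSpace ℝ (Fin (k + 1)))).measurePreserving_homeomorphUnitSphereProd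
  have h2 := h1.lintegral_comp (f := fun p => f p.2)
    (hf.comp (measurable_subtype_coe.comp measurable_snd))
  simp only [homeomorphUnitSphereProd_apply_snd_coe] at h2
  rw [lintegral_subtype_comap (measurableSet_singleton _).compl (fun x => f ‖x‖),
    restrict_compl_singleton] at h2
  rw [h2, lintegral_prod _ (by fun_prop)]
  simp only [lintegral_const, Measure.toSphere_apply_univ]
  rw [mul_comm]
  congr 1
  · simp
  · rw [Measure.volumeIoiPow, lintegral_withDensity_eq_lintegral_mul _ (by fun_prop) (by fun_prop)]
    simp only [Pi.mul_apply, finrank_euclideanSpace, Fintype.card_fin, Nat.add_sub_cancel]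
    exact lintegral_subtype_comap measurableSet_Ioi (fun r => ENNReal.ofReal (r ^ k) * f r)

/-- The reflection in the hyperplane orthogonal to `a - b` exchanges two vectors of equal norm. -/
theorem exists_linearIsometryEquiv_map_eq {E : Type*} [NormedAddCommGroup E]
    [InnerProductSpace ℝ E] {a b : E} (h : ‖a‖ = ‖b‖) : ∃ L : E ≃ₗᵢ[ℝ] E, L a = b :=
  ⟨_, Submodule.reflection_sub h⟩

theorem map_eq_map_of_lintegral_eq {X Y : Type*} [MeasurableSpace X] [MeasurableSpace Y]
    {μ : Measure X} {κ : Measure Y} {ρ : X → ℝ} {r : Y → ℝ} (hρ : Measurable ρ)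
    (hr : Measurable r)
    (h : ∀ φ : ℝ → ℝ≥0∞, Measurable φ → ∫⁻ x, φ (ρ x) ∂μ = ∫⁻ y, φ (r y) ∂κ) :
    μ.map ρ = κ.map r := by
  ext s hs
  have := h (s.indicator 1) (measurable_one.indicator hs)
  rwa [← lintegral_map (measurable_one.indicator hs) hρ,
    ← lintegral_map (measurable_one.indicator hs) hr, lintegral_indicator_one hs,
    lintegral_indicator_one hs] at this

/-- Agreement on all nonnegative test functions means that the two pushforwards to the line
coincide. Distance laws can thus be proved with lower integrals and then applied to the complex
kernel. -/
theorem integral_eq_and_integrable_iff_of_lintegral_eq {X Y : Type*} [MeasurableSpace X]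
    [MeasurableSpace Y] {μ : Measure X} {κ : Measure Y} {ρ : X → ℝ} {r : Y → ℝ}
    (hρ : Measurable ρ) (hr : Measurable r)
    (h : ∀ φ : ℝ → ℝ≥0∞, Measurable φ → ∫⁻ x, φ (ρ x) ∂μ = ∫⁻ y, φ (r y) ∂κ) {F : ℝ → ℂ}
    (hF : Measurable F) : ∫ x, F (ρ x) ∂μ = ∫ y, F (r y) ∂κ ∧
      (Integrable (fun x => F (ρ x)) μ ↔ Integrable (fun y => F (r y)) κ) := by
  have hm := map_eq_map_of_lintegral_eq hρ hr h
  constructor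
  · rw [← integral_map hρ.aemeasurable hF.aestronglyMeasurable, hm,
      integral_map hr.aemeasurable hF.aestronglyMeasurable]
  · have h1 := integrable_map_measure (μ := μ) hF.aestronglyMeasurable hρ.aemeasurable
    have h2 := integrable_map_measure (μ := κ) hF.aestronglyMeasurable hr.aemeasurable
    rw [hm] at h1
    exact h1.symm.trans h2

end Slicing

/-! ### Law of the distance between two points of the unit ball -/

section BallLaw

open Metric
open scoped NNReal ENNReal

variable {k : ℕ}

/-- After a reflection h points along the first axis. On the line over v the ball cuts a chord of
length `2 * √(1 - ‖v‖ ^ 2)`, and intersecting with the translated ball shortens it by `‖h‖`.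
Truncation at 0 in `ENNReal.ofReal` and in the square root covers the empty cases. -/
theorem volume_closedBall_inter_preimage_add (h : EuclideanSpace ℝ (Fin (k + 1))) :
    volume (closedBall 0 1 ∩ (fun x => x + h) ⁻¹' closedBall 0 1) =
      ∫⁻ v : EuclideanSpace ℝ (Fin k), ENNReal.ofReal (2 * √(1 - ‖v‖ ^ 2) - ‖h‖) := by
  classical
  obtain ⟨L, hL⟩ := exists_linearIsometryEquiv_map_eq (a := consPoint ‖h‖ 0) (b := h) (by
    have : (consPoint ‖h‖ 0 : EuclideanSpace ℝ (Fin (k + 1))) = ‖h‖ • consPoint 1 0 := by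
      rw [consPoint_smul]; simp
    rw [this, norm_smul, norm_consPoint_one_zero]
    simp)
  rw [← L.measurePreserving.measure_preimage (measurableSet_closedBall.inter
    (measurableSet_closedBall.preimage (measurable_add_const h))).nullMeasurableSet]
  have hpre : L ⁻¹' (closedBall 0 1 ∩ (fun x => x + h) ⁻¹' closedBall 0 1) =
      closedBall 0 1 ∩ (fun x => x + consPoint ‖h‖ 0) ⁻¹' closedBall 0 1 := by
    ext x
    simp only [Set.mem_preimage, Set.mem_inter_iff, mem_closedBall_zero_iff, L.norm_map]
    nth_rewrite 1 [← hL]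
    rw [← map_add, L.norm_map]
  have hms : MeasurableSet (closedBall 0 1 ∩ (fun x : EuclideanSpace ℝ (Fin (k + 1)) =>
      x + consPoint ‖h‖ 0) ⁻¹' closedBall 0 1) :=
    measurableSet_closedBall.inter (measurableSet_closedBall.preimage (measurable_add_const _))
  rw [hpre, ← lintegral_indicator_one hms,
    lintegral_eq_lintegral_consPoint (measurable_one.indicator hms)]
  refine lintegral_congr fun v => ?_
  have hsec : ∀ t : ℝ, (closedBall 0 1 ∩ (fun x : EuclideanSpace ℝ (Fin (k + 1)) =>
      x + consPoint ‖h‖ 0) ⁻¹' closedBall 0 1).indicator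
        (1 : EuclideanSpace ℝ (Fin (k + 1)) → ℝ≥0∞) (consPoint t v) =
      ({t | t ^ 2 + ‖v‖ ^ 2 ≤ 1 ∧ (t + ‖h‖) ^ 2 + ‖v‖ ^ 2 ≤ 1} : Set ℝ).indicator 1 t := by
    intro t
    have hb : ∀ x : EuclideanSpace ℝ (Fin (k + 1)), x ∈ closedBall (0 : EuclideanSpace ℝ
        (Fin (k + 1))) 1 ↔ ‖x‖ ^ 2 ≤ 1 := fun x => by
      rw [mem_closedBall_zero_iff, sq_le_one_iff₀ (norm_nonneg x)]
    simp only [Set.indicator_apply, Set.mem_inter_iff, Set.mem_preimage, hb, consPoint_add,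
      norm_sq_consPoint, add_zero, Set.mem_ofPred_eq, Pi.one_apply]
  simp only [hsec]
  have hn := norm_nonneg h
  by_cases hv : ‖v‖ ^ 2 ≤ 1
  · have hset : ({t | t ^ 2 + ‖v‖ ^ 2 ≤ 1 ∧ (t + ‖h‖) ^ 2 + ‖v‖ ^ 2 ≤ 1} : Set ℝ) =
        Set.Icc (-√(1 - ‖v‖ ^ 2)) (√(1 - ‖v‖ ^ 2) - ‖h‖) := by
      ext t
      have h1 : ∀ s : ℝ, s ^ 2 + ‖v‖ ^ 2 ≤ 1 ↔ -√(1 - ‖v‖ ^ 2) ≤ s ∧ s ≤ √(1 - ‖v‖ ^ 2) := by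
        intro s
        rw [← abs_le, ← Real.sqrt_sq_eq_abs, Real.sqrt_le_sqrt_iff (by linarith)]
        constructor <;> intro <;> linarith
      simp only [Set.mem_ofPred_eq, h1, Set.mem_Icc]
      constructor
      · rintro ⟨⟨h2, h3⟩, h4, h5⟩
        constructor <;> linarith
      · rintro ⟨h2, h3⟩
        refine ⟨⟨?_, ?_⟩, ?_, ?_⟩ <;> linarith
    rw [hset, lintegral_indicator_one measurableSet_Icc, Real.volume_Icc]
    congr 1
    ring
  · have hset : ({t | t ^ 2 + ‖v‖ ^ 2 ≤ 1 ∧ (t + ‖h‖) ^ 2 + ‖v‖ ^ 2 ≤ 1} : Set ℝ) = ∅ := by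
      ext t
      simp only [Set.mem_ofPred_eq, Set.mem_empty_iff_false, iff_false]
      rintro ⟨h2, -⟩
      nlinarith [sq_nonneg t]
    rw [hset, Real.sqrt_eq_zero_of_nonpos (by linarith)]
    simp [ENNReal.ofReal_of_nonpos, hn]

/-- The law of the distance between two points of the unit ball. -/
theorem lintegral_dist_closedBall {φ : ℝ → ℝ≥0∞} (hφ : Measurable φ) :
    ∫⁻ p : EuclideanSpace ℝ (Fin (k + 1)) × EuclideanSpace ℝ (Fin (k + 1)), φ ‖p.1 - p.2‖
      ∂((volume.restrict (closedBall 0 1)).prod (volume.restrict (closedBall 0 1))) =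
    ((k + 1 : ℕ) * volume (ball (0 : EuclideanSpace ℝ (Fin (k + 1))) 1)) *
      ∫⁻ r in Set.Ioi (0 : ℝ), ENNReal.ofReal (r ^ k) *
        (φ r * ∫⁻ v : EuclideanSpace ℝ (Fin k), ENNReal.ofReal (2 * √(1 - ‖v‖ ^ 2) - r)) := by
  have hb : MeasurableSet (closedBall (0 : EuclideanSpace ℝ (Fin (k + 1))) 1) :=
    measurableSet_closedBall
  have hV : Measurable (fun r : ℝ => ∫⁻ v : EuclideanSpace ℝ (Fin k),
      ENNReal.ofReal (2 * √(1 - ‖v‖ ^ 2) - r)) :=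
    Measurable.lintegral_prod_right' (f := fun p : ℝ × EuclideanSpace ℝ (Fin k) =>
      ENNReal.ofReal (2 * √(1 - ‖p.2‖ ^ 2) - p.1)) (by fun_prop)
  have hrad := lintegral_fun_norm_euclidean (k := k) (hφ.mul hV)
  simp only [Pi.mul_apply] at hrad
  rw [← hrad, lintegral_prod _ (by fun_prop)]
  set b : EuclideanSpace ℝ (Fin (k + 1)) → ℝ≥0∞ := (closedBall 0 1).indicator 1 with hbdef
  have hbm : Measurable b := measurable_one.indicator hb
  have hset : ∀ g : EuclideanSpace ℝ (Fin (k + 1)) → ℝ≥0∞,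
      ∫⁻ x in closedBall 0 1, g x = ∫⁻ x, b x * g x := by
    intro g
    rw [← lintegral_indicator hb]
    refine lintegral_congr fun x => ?_
    by_cases hx : x ∈ closedBall (0 : EuclideanSpace ℝ (Fin (k + 1))) 1 <;> simp [hbdef, hx]
  simp only [hset]
  -- The substitution y = x + h makes the kernel depend on h only; after exchanging the integrals,
  -- the integral over x is the volume of the overlap of the ball with its translate.
  have h1 : ∀ x : EuclideanSpace ℝ (Fin (k + 1)), ∫⁻ y, b y * φ ‖x - y‖ =
      ∫⁻ h, b (x + h) * φ ‖h‖ := by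
    intro x
    rw [← lintegral_add_left_eq_self _ x]
    simp
  simp only [h1]
  have h2 : ∀ x : EuclideanSpace ℝ (Fin (k + 1)), b x * ∫⁻ h, b (x + h) * φ ‖h‖ =
      ∫⁻ h, b x * (b (x + h) * φ ‖h‖) := fun x => (lintegral_const_mul _ (by fun_prop)).symm
  simp only [h2]
  rw [lintegral_lintegral_swap (by fun_prop)]
  refine lintegral_congr fun h => ?_
  rw [← volume_closedBall_inter_preimage_add h, ← lintegral_indicator_one
    (hb.inter (hb.preimage (measurable_add_const h))), ← lintegral_const_mul _
    (measurable_one.indicator (hb.inter (hb.preimage (measurable_add_const h))))]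
  refine lintegral_congr fun x => ?_
  classical
  simp only [hbdef, Set.indicator_apply, Set.mem_inter_iff, Set.mem_preimage, Pi.one_apply]
  by_cases hx : x ∈ closedBall (0 : EuclideanSpace ℝ (Fin (k + 1))) 1 <;>
  by_cases hxh : x + h ∈ closedBall (0 : EuclideanSpace ℝ (Fin (k + 1))) 1 <;>
  simp only [hx, hxh] <;> simp

end BallLaw

/-! ### Analyticity of Gamma factors -/

section GammaFactors

theorem ofReal_sqrt_cpow {x : ℝ} (hx : 0 < x) (s : ℂ) : ((√x : ℝ) : ℂ) ^ s = (x : ℂ) ^ (s / 2) := by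
  rw [Complex.cpow_def_of_ne_zero (by exact_mod_cast (Real.sqrt_pos.2 hx).ne'),
    Complex.cpow_def_of_ne_zero (by exact_mod_cast hx.ne'), ← Complex.ofReal_log hx.le,
    ← Complex.ofReal_log (Real.sqrt_nonneg x), Real.log_sqrt hx.le]
  congr 1
  push_cast
  ring

/-- The reciprocal Gamma function is entire; inverting it gives meromorphy of Gamma everywhere and
analyticity off the poles. -/
theorem analyticAt_inv_Gamma_comp (b z : ℂ) :
    AnalyticAt ℂ (fun z => (Complex.Gamma (z / 2 + b))⁻¹) z := by
  have h1 : Differentiable ℂ (fun z : ℂ => z / 2 + b) := by fun_prop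
  exact (Complex.differentiable_one_div_Gamma.comp h1).analyticAt z

theorem meromorphicAt_Gamma_comp (b z : ℂ) :
    MeromorphicAt (fun z => Complex.Gamma (z / 2 + b)) z := by
  have h := (analyticAt_inv_Gamma_comp b z).meromorphicAt.inv
  have he : (fun z => (Complex.Gamma (z / 2 + b))⁻¹)⁻¹ = fun z => Complex.Gamma (z / 2 + b) := by
    funext
    simp
  rwa [he] at h

theorem analyticAt_Gamma_comp {b z : ℂ} (h : ∀ j : ℕ, z / 2 + b ≠ -(j : ℂ)) :
    AnalyticAt ℂ (fun z => Complex.Gamma (z / 2 + b)) z := by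
  have h := (analyticAt_inv_Gamma_comp b z).inv (inv_ne_zero (Complex.Gamma_ne_zero h))
  have he : (fun z => (Complex.Gamma (z / 2 + b))⁻¹)⁻¹ = fun z => Complex.Gamma (z / 2 + b) := by
    funext
    simp
  rwa [he] at h

theorem analyticAt_inv_add (b z : ℂ) (h : z + b ≠ 0) : AnalyticAt ℂ (fun z : ℂ => (z + b)⁻¹) z :=
  (analyticAt_id.add analyticAt_const).inv h

theorem meromorphicAt_inv_add (b z : ℂ) : MeromorphicAt (fun z : ℂ => (z + b)⁻¹) z :=
  (analyticAt_id.add analyticAt_const).meromorphicAt.inv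

end GammaFactors

/-! ### Continuation of the energy of the unit ball -/

section BallEnergy

open Metric
open scoped NNReal ENNReal

variable {k : ℕ}

/-- On (0, b] the integrand is `c * (b - r) * r ^ (z + k)`, and `1 / (z + k + 1) - 1 / (z + k + 2)`
is the product of the two reciprocals. The case b = 0 is needed for degenerate chords. -/
theorem integral_Ioi_pow_mul_max_mul_cpow (c : ℝ) {b : ℝ} (hb : 0 ≤ b) {z : ℂ}
    (hz : -((k : ℝ) + 1) < z.re) :
    ∫ r in Set.Ioi (0 : ℝ), (c * (max (r ^ k) 0 * max (b - r) 0)) • (r : ℂ) ^ z =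
      c / ((z + k + 1) * (z + k + 2)) * (b : ℂ) ^ (z + k + 2) := by
  have hsub : Set.Ioc (0 : ℝ) b ⊆ Set.Ioi 0 := fun x hx => hx.1
  rw [setIntegral_eq_of_subset_of_forall_sdiff_eq_zero measurableSet_Ioi hsub]
  · rw [← intervalIntegral.integral_of_le hb]
    have hre : -1 < (z + k).re := by simp; linarith
    have hre' : -1 < (z + k + 1).re := by simp; linarith
    have h1 : (z + k + 1) ≠ 0 := fun h => by
      have := congrArg Complex.re h
      simp at this
      linarith
    have h2 : (z + k + 2) ≠ 0 := fun h => by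
      have := congrArg Complex.re h
      simp at this
      linarith
    have hcongr : ∫ r in (0 : ℝ)..b, (c * (max (r ^ k) 0 * max (b - r) 0)) • (r : ℂ) ^ z =
        ∫ r in (0 : ℝ)..b, ((c * b : ℂ) * (r : ℂ) ^ (z + k) - c * (r : ℂ) ^ (z + k + 1)) := by
      refine intervalIntegral.integral_congr_ae (Filter.Eventually.of_forall fun r hr => ?_)
      rw [Set.uIoc_of_le hb] at hr
      have hr0 : (r : ℂ) ≠ 0 := by exact_mod_cast hr.1.ne'
      rw [max_eq_left (pow_nonneg hr.1.le k), max_eq_left (sub_nonneg.2 hr.2), Complex.real_smul,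
        Complex.cpow_add _ 1 hr0, Complex.cpow_add z k hr0, Complex.cpow_natCast, Complex.cpow_one]
      push_cast
      ring
    rw [hcongr, intervalIntegral.integral_sub
      ((intervalIntegral.intervalIntegrable_cpow' hre).const_mul _)
      ((intervalIntegral.intervalIntegrable_cpow' hre').const_mul _),
      intervalIntegral.integral_const_mul, intervalIntegral.integral_const_mul,
      integral_cpow (Or.inl hre), integral_cpow (Or.inl hre')]
    have h3 : z + k + 1 + 1 = z + k + 2 := by ring
    rw [h3, Complex.ofReal_zero, Complex.zero_cpow h1, Complex.zero_cpow h2]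
    rcases hb.eq_or_lt with rfl | hb'
    · simp [h2, h1]
    · have hb0 : (b : ℂ) ≠ 0 := by exact_mod_cast hb'.ne'
      have h4 : (b : ℂ) ^ (z + k + 2) = b ^ (z + k + 1) * b := by
        rw [← h3, Complex.cpow_add _ _ hb0, Complex.cpow_one]
      rw [h4]
      field_simp
      ring
  · intro r hr
    have : b < r := by
      by_contra h
      exact hr.2 ⟨hr.1, not_lt.1 h⟩
    rw [max_eq_right (sub_nonpos.2 this.le)]
    simp

theorem two_mul_sqrt_le_two (v : EuclideanSpace ℝ (Fin k)) : 2 * √(1 - ‖v‖ ^ 2) ≤ 2 := by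
  have : √(1 - ‖v‖ ^ 2) ≤ 1 := by
    exact Real.sqrt_le_iff.2 ⟨zero_le_one, by nlinarith [sq_nonneg ‖v‖]⟩
  linarith

theorem two_mul_sqrt_eq_zero {v : EuclideanSpace ℝ (Fin k)} (hv : 1 < ‖v‖) :
    2 * √(1 - ‖v‖ ^ 2) = 0 := by
  rw [Real.sqrt_eq_zero_of_nonpos (by nlinarith), mul_zero]

/-- Chords have length at most 2 and vanish for v outside the unit ball, so `2 * |c| * r ^ (z.re +
k)` on (0, 2] times the unit ball dominates; the exponent exceeds -1. -/
theorem integrable_chord_kernel (c : ℝ) {z : ℂ} (hz : -((k : ℝ) + 1) < z.re) :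
    Integrable (fun p : ℝ × EuclideanSpace ℝ (Fin k) =>
      (c * (max (p.1 ^ k) 0 * max (2 * √(1 - ‖p.2‖ ^ 2) - p.1) 0)) • (p.1 : ℂ) ^ z)
      ((volume.restrict (Set.Ioi 0)).prod volume) := by
  have h1 : Integrable (fun r : ℝ => (Set.Ioc (0 : ℝ) 2).indicator
      (fun r => r ^ (z.re + k)) r) (volume.restrict (Set.Ioi 0)) := by
    rw [integrable_indicator_iff measurableSet_Ioc]
    have := (intervalIntegrable_iff_integrableOn_Ioc_of_le zero_le_two).1
      (intervalIntegral.intervalIntegrable_rpow' (a := 0) (b := 2) (r := z.re + k) (by linarith))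
    exact this.mono_measure Measure.restrict_le_self
  have h2 : Integrable (fun v : EuclideanSpace ℝ (Fin k) =>
      (closedBall (0 : EuclideanSpace ℝ (Fin k)) 1).indicator (fun _ => (1 : ℝ)) v) := by
    rw [integrable_indicator_iff measurableSet_closedBall]
    exact integrableOn_const measure_closedBall_lt_top.ne
  have h3 := (h1.mul_prod h2).const_mul (|c| * 2)
  have hac : ∀ᵐ p ∂((volume.restrict (Set.Ioi (0 : ℝ))).prod
      (volume : Measure (EuclideanSpace ℝ (Fin k)))), 0 < p.1 :=
    Measure.quasiMeasurePreserving_fst.ae (ae_restrict_mem measurableSet_Ioi)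
  refine h3.mono' ?_ ?_
  · have hm1 : Measurable (fun p : ℝ × EuclideanSpace ℝ (Fin k) =>
        c * (max (p.1 ^ k) 0 * max (2 * √(1 - ‖p.2‖ ^ 2) - p.1) 0)) := by fun_prop
    have hm2 : Measurable (fun p : ℝ × EuclideanSpace ℝ (Fin k) => (p.1 : ℂ) ^ z) :=
      Measurable.pow_const (by fun_prop) z
    exact (hm1.smul hm2).aestronglyMeasurable
  · filter_upwards [hac] with p hp
    by_cases hv : ‖p.2‖ ≤ 1
    · by_cases hr : p.1 ≤ 2
      · have h4 : p.1 ∈ Set.Ioc (0 : ℝ) 2 := ⟨hp, hr⟩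
        have h5 : p.2 ∈ closedBall (0 : EuclideanSpace ℝ (Fin k)) 1 := by simpa using hv
        rw [Set.indicator_of_mem h4, Set.indicator_of_mem h5, norm_smul,
          Complex.norm_cpow_eq_rpow_re_of_pos hp, Real.rpow_add hp, Real.rpow_natCast,
          Real.norm_eq_abs, abs_mul, abs_mul, max_eq_left (pow_nonneg hp.le k),
          abs_of_nonneg (pow_nonneg hp.le k), abs_of_nonneg (le_max_right (2 * √(1 - ‖p.2‖ ^ 2) - p.1) 0)]
        have h6 : max (2 * √(1 - ‖p.2‖ ^ 2) - p.1) 0 ≤ 2 :=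
          max_le (by linarith [two_mul_sqrt_le_two p.2]) zero_le_two
        have h7 : 0 ≤ |c| * p.1 ^ k * p.1 ^ z.re := by positivity
        nlinarith [mul_le_mul_of_nonneg_left h6 h7]
      · rw [max_eq_right (b := (0 : ℝ)) (a := 2 * √(1 - ‖p.2‖ ^ 2) - p.1)
          (by linarith [two_mul_sqrt_le_two p.2])]
        simp [hr]
    · rw [two_mul_sqrt_eq_zero (not_le.1 hv), max_eq_right (b := (0 : ℝ)) (a := 0 - p.1)
        (by linarith)]
      simp [hv]

/-- The energy of the unit ball as an integral over the chords parallel to an axis. -/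
theorem integral_dist_closedBall {z : ℂ} (hz : -((k : ℝ) + 1) < z.re) :
    Integrable (fun p : EuclideanSpace ℝ (Fin (k + 1)) × EuclideanSpace ℝ (Fin (k + 1)) =>
      ((‖p.1 - p.2‖ : ℝ) : ℂ) ^ z)
      ((volume.restrict (closedBall 0 1)).prod (volume.restrict (closedBall 0 1))) ∧
    ∫ p : EuclideanSpace ℝ (Fin (k + 1)) × EuclideanSpace ℝ (Fin (k + 1)),
      ((‖p.1 - p.2‖ : ℝ) : ℂ) ^ z
      ∂((volume.restrict (closedBall 0 1)).prod (volume.restrict (closedBall 0 1))) =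
    (((k + 1 : ℕ) * volume.real (ball (0 : EuclideanSpace ℝ (Fin (k + 1))) 1) : ℝ) : ℂ) /
      ((z + k + 1) * (z + k + 2)) *
      ∫ v : EuclideanSpace ℝ (Fin k), ((2 * √(1 - ‖v‖ ^ 2) : ℝ) : ℂ) ^ (z + k + 2) := by
  set c : ℝ≥0∞ := (k + 1 : ℕ) * volume (ball (0 : EuclideanSpace ℝ (Fin (k + 1))) 1) with hc
  have hctop : c ≠ ⊤ := ENNReal.mul_ne_top (by simp) measure_ball_lt_top.ne
  have hcr : ((k + 1 : ℕ) * volume.real (ball (0 : EuclideanSpace ℝ (Fin (k + 1))) 1) : ℝ) =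
      c.toReal := by
    rw [hc, ENNReal.toReal_mul, Measure.real, ENNReal.toReal_natCast]
  rw [hcr]
  -- The distance is realised as the first coordinate of the pair (r, v) under the density `d`.
  -- Keeping v as a variable lets Fubini integrate over r first, in closed form.
  set d : ℝ × EuclideanSpace ℝ (Fin k) → ℝ≥0∞ := fun p =>
    c * (ENNReal.ofReal (p.1 ^ k) * ENNReal.ofReal (2 * √(1 - ‖p.2‖ ^ 2) - p.1)) with hd
  have hdm : Measurable d := by fun_prop
  have hdt : ∀ p, d p < ⊤ := fun p => ENNReal.mul_lt_top hctop.lt_top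
    (ENNReal.mul_lt_top ENNReal.ofReal_lt_top ENNReal.ofReal_lt_top)
  have hdr : ∀ p, (d p).toReal =
      c.toReal * (max (p.1 ^ k) 0 * max (2 * √(1 - ‖p.2‖ ^ 2) - p.1) 0) := by
    intro p
    simp only [hd, ENNReal.toReal_mul, ENNReal.toReal_ofReal']
  have hlaw : ∀ φ : ℝ → ℝ≥0∞, Measurable φ →
      ∫⁻ p : EuclideanSpace ℝ (Fin (k + 1)) × EuclideanSpace ℝ (Fin (k + 1)), φ ‖p.1 - p.2‖
      ∂((volume.restrict (closedBall 0 1)).prod (volume.restrict (closedBall 0 1))) =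
      ∫⁻ p, φ p.1 ∂(((volume.restrict (Set.Ioi 0)).prod volume).withDensity d) := by
    intro φ hφ
    rw [lintegral_dist_closedBall hφ, lintegral_withDensity_eq_lintegral_mul _ hdm (by fun_prop),
      lintegral_prod _ (by fun_prop), ← lintegral_const_mul' _ _ hctop]
    refine lintegral_congr fun r => ?_
    rw [← lintegral_const_mul _ (by fun_prop), ← lintegral_const_mul _ (by fun_prop),
      ← lintegral_const_mul _ (by fun_prop)]
    refine lintegral_congr fun v => ?_
    simp only [hd, Pi.mul_apply]
    ring
  have hF : Measurable (fun r : ℝ => (r : ℂ) ^ z) := Measurable.pow_const (by fun_prop) z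
  obtain ⟨h1, h2⟩ := integral_eq_and_integrable_iff_of_lintegral_eq (by fun_prop) measurable_fst
    hlaw hF
  have hint := integrable_chord_kernel (k := k) c.toReal hz
  constructor
  · rw [h2, integrable_withDensity_iff_integrable_smul' hdm (Filter.Eventually.of_forall hdt)]
    simp only [hdr]
    exact hint
  · rw [h1, integral_withDensity_eq_integral_toReal_smul hdm (Filter.Eventually.of_forall hdt)]
    simp only [hdr]
    rw [integral_prod_symm _ hint, ← integral_const_mul]
    refine integral_congr_ae (Filter.Eventually.of_forall fun v => ?_)
    exact integral_Ioi_pow_mul_max_mul_cpow c.toReal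
      (by positivity : 0 ≤ 2 * √(1 - ‖v‖ ^ 2)) hz

/-- Polar coordinates in v followed by u = r² give a Beta integral. Outside the unit ball the
integrand is `0 ^ s`, which is 0 because s is nonzero. -/
theorem integral_chord_cpow {s : ℂ} (hs : 0 < s.re) :
    ∫ v : EuclideanSpace ℝ (Fin (k + 1)), ((2 * √(1 - ‖v‖ ^ 2) : ℝ) : ℂ) ^ s =
      (((k + 1 : ℕ) * volume.real (ball (0 : EuclideanSpace ℝ (Fin (k + 1))) 1) : ℝ) : ℂ) / 2 *
        2 ^ s * Complex.betaIntegral ((k + 1 : ℂ) / 2) (s / 2 + 1) := by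
  have hs0 : s ≠ 0 := fun h => by simp [h] at hs
  set g : ℝ → ℂ := fun u => ((u ^ (((k : ℝ) - 1) / 2) / 2 : ℝ) : ℂ) *
    ((2 * √(1 - u) : ℝ) : ℂ) ^ s with hg
  have h1 : ∫ r in Set.Ioi (0 : ℝ), r ^ k • ((2 * √(1 - r ^ 2) : ℝ) : ℂ) ^ s =
      ∫ u in Set.Ioi (0 : ℝ), g u := by
    rw [← integral_comp_rpow_Ioi g two_ne_zero]
    refine setIntegral_congr_fun measurableSet_Ioi fun r hr => ?_
    have hr0 : (0 : ℝ) < r := hr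
    have h2 : (r ^ (2 : ℝ)) ^ (((k : ℝ) - 1) / 2) * r = r ^ k := by
      rw [← Real.rpow_mul hr0.le, mul_div_cancel₀ _ two_ne_zero, Real.rpow_sub hr0,
        Real.rpow_natCast, Real.rpow_one]
      field_simp
    simp only [hg]
    rw [Real.rpow_two] at h2 ⊢
    rw [← h2, Complex.real_smul, Complex.real_smul]
    norm_num
    ring
  have h3 : ∫ u in Set.Ioi (0 : ℝ), g u = 2 ^ s / 2 *
      Complex.betaIntegral ((k + 1 : ℂ) / 2) (s / 2 + 1) := by
    have hsub : Set.Ioc (0 : ℝ) 1 ⊆ Set.Ioi 0 := fun x hx => hx.1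
    rw [setIntegral_eq_of_subset_of_forall_sdiff_eq_zero measurableSet_Ioi hsub,
      Complex.betaIntegral, ← intervalIntegral.integral_of_le zero_le_one,
      ← intervalIntegral.integral_const_mul]
    · refine intervalIntegral.integral_congr_ae (Filter.Eventually.of_forall fun u hu => ?_)
      rw [Set.uIoc_of_le zero_le_one] at hu
      have hu1 : ((2 * √(1 - u) : ℝ) : ℂ) ^ s = 2 ^ s * (1 - (u : ℂ)) ^ (s / 2) := by
        rw [Complex.ofReal_mul, Complex.mul_cpow_ofReal_nonneg zero_le_two (Real.sqrt_nonneg _)]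
        congr 1
        rcases hu.2.eq_or_lt with rfl | h
        · simp [hs0]
        · rw [ofReal_sqrt_cpow (by linarith)]
          push_cast
          rfl
      simp only [hg, hu1, add_sub_cancel_right]
      rw [Complex.ofReal_div, Complex.ofReal_cpow hu.1.le]
      have h4 : ((((k : ℝ) - 1) / 2 : ℝ) : ℂ) = ((k : ℂ) + 1) / 2 - 1 := by
        push_cast
        ring
      rw [h4]
      push_cast
      ring
    · intro u hu
      have : 1 < u := by
        by_contra h
        exact hu.2 ⟨hu.1, not_lt.1 h⟩
      simp [hg, Real.sqrt_eq_zero_of_nonpos (by linarith : 1 - u ≤ 0), hs0]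
  rw [integral_fun_norm_addHaar volume (fun r : ℝ => ((2 * √(1 - r ^ 2) : ℝ) : ℂ) ^ s)]
  simp only [finrank_euclideanSpace, Fintype.card_fin, Nat.add_sub_cancel]
  rw [h1, h3, nsmul_eq_mul, Complex.real_smul]
  push_cast
  ring

theorem integral_euclideanSpace_zero (f : EuclideanSpace ℝ (Fin 0) → ℂ) : ∫ v, f v = f 0 := by
  rw [volume_euclideanSpace_eq_dirac, integral_dirac]

theorem exists_hasContinuation_closedBall (k : ℕ) :
    ∃ A : ℂ → ℂ, HasContinuation (k + 1)
      (volume.restrict (closedBall (0 : EuclideanSpace ℝ (Fin (k + 1))) 1)) A ∧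
      ∀ z ∉ bodyPoles (k + 1), AnalyticAt ℂ A z := by
  have hreg : ∀ z : ℂ, -((k + 1 : ℕ) : ℝ) < z.re → z ∉ bodyPoles (k + 1) := by
    rintro z hz (rfl | ⟨j, rfl⟩)
    · simp at hz
    · have : (0 : ℝ) ≤ j := j.cast_nonneg
      simp at hz
      linarith
  -- In dimension 1 the space of chords is a single point and no Beta integral occurs; the two
  -- rational factors give the poles -1 and -2.
  rcases k with _ | k
  · set C : ℂ := (((0 + 1 : ℕ) * volume.real (ball (0 : EuclideanSpace ℝ (Fin (0 + 1))) 1) : ℝ) : ℂ)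
    have han : ∀ z ∉ bodyPoles (0 + 1), AnalyticAt ℂ (fun z : ℂ =>
        C * 4 * ((2 : ℝ) : ℂ) ^ z * ((z + 1)⁻¹ * (z + 2)⁻¹)) z := by
      intro z hz
      have h1 : z + 1 ≠ 0 := fun h => hz (Or.inl (by linear_combination h))
      have h2 : z + 2 ≠ 0 := fun h => hz (Or.inr ⟨0, by push_cast; linear_combination h⟩)
      exact (analyticAt_const.mul (analyticAt_ofReal_const_cpow two_pos z)).mul
        ((analyticAt_inv_add 1 z h1).mul (analyticAt_inv_add 2 z h2))
    refine ⟨fun z => C * 4 * ((2 : ℝ) : ℂ) ^ z * ((z + 1)⁻¹ * (z + 2)⁻¹), ⟨?_, ?_, ?_, ?_⟩, han⟩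
    · intro z _
      exact (analyticAt_const.mul (analyticAt_ofReal_const_cpow two_pos z)).meromorphicAt.mul
        ((meromorphicAt_inv_add 1 z).mul (meromorphicAt_inv_add 2 z))
    · exact fun z hz => han z (hreg z hz)
    · exact fun z hz => (integral_dist_closedBall (by simpa using hz)).1
    · intro z hz
      rw [(integral_dist_closedBall (by simpa using hz)).2, integral_euclideanSpace_zero]
      have h2 : (2 : ℂ) ^ (z + 2) = 2 ^ z * 4 := by
        rw [Complex.cpow_add _ _ two_ne_zero, Complex.cpow_ofNat]
        norm_num
      simp only [Nat.cast_zero, add_zero, norm_zero]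
      norm_num
      rw [h2]
      simp only [C]
      rw [div_eq_mul_inv, mul_inv]
      norm_num
      ring
  · set c1 : ℝ := ((k + 1 + 1 : ℕ) *
      volume.real (ball (0 : EuclideanSpace ℝ (Fin (k + 1 + 1))) 1) : ℝ) with hc1
    set c2 : ℝ := ((k + 1 : ℕ) *
      volume.real (ball (0 : EuclideanSpace ℝ (Fin (k + 1))) 1) : ℝ) with hc2
    set C : ℂ := c1 * c2 * Complex.Gamma ((k + 1 : ℂ) / 2) * 2 ^ (k + 1) with hC
    have han : ∀ z ∉ bodyPoles (k + 1 + 1), AnalyticAt ℂ (fun z : ℂ =>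
        C * ((2 : ℝ) : ℂ) ^ z * (Complex.Gamma (z / 2 + (k + 3) / 2) * (z + (k + 2))⁻¹ *
          (Complex.Gamma (z / 2 + (k + 3)))⁻¹)) z := by
      intro z hz
      have h1 : z + ((k : ℂ) + 2) ≠ 0 := fun h =>
        hz (Or.inl (by push_cast; linear_combination h))
      have h2 : ∀ j : ℕ, z / 2 + ((k : ℂ) + 3) / 2 ≠ -(j : ℂ) := fun j h =>
        hz (Or.inr ⟨j, by push_cast; linear_combination 2 * h⟩)
      exact (analyticAt_const.mul (analyticAt_ofReal_const_cpow two_pos z)).mul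
        (((analyticAt_Gamma_comp h2).mul (analyticAt_inv_add _ z h1)).mul
          (analyticAt_inv_Gamma_comp _ z))
    refine ⟨_, ⟨?_, ?_, ?_, ?_⟩, han⟩
    · intro z _
      exact (analyticAt_const.mul (analyticAt_ofReal_const_cpow two_pos z)).meromorphicAt.mul
        (((meromorphicAt_Gamma_comp _ z).mul (meromorphicAt_inv_add _ z)).mul
          (analyticAt_inv_Gamma_comp _ z).meromorphicAt)
    · exact fun z hz => han z (hreg z hz)
    · exact fun z hz => (integral_dist_closedBall (by simpa using hz)).1
    · intro z hz
      have hz' : -((k : ℝ) + 2) < z.re := by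
        have : ((k + 1 + 1 : ℕ) : ℝ) = k + 2 := by push_cast; ring
        rwa [this] at hz
      have hs : 0 < (z + (k + 1 : ℕ) + 2).re := by
        simp
        linarith
      rw [(integral_dist_closedBall (by simpa using hz)).2, integral_chord_cpow hs,
        Complex.betaIntegral_eq_Gamma_mul_div]
      · rw [← hc1, ← hc2]
        have hne : z / 2 + ((k : ℂ) + 3) / 2 ≠ 0 := fun h => by
          have := congrArg Complex.re h
          simp at this
          linarith
        -- The functional equation of Gamma absorbs the factor z + n + 1 of the denominator, with n
        -- = k + 2. What remains is a simple factor at -n and a Gamma factor with poles -n - 1 - 2j,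
        -- as `bodyPoles` prescribes.
        have h1 : Complex.Gamma ((z + (k + 1 : ℕ) + 2) / 2 + 1) = (z / 2 + (k + 3) / 2) *
            Complex.Gamma (z / 2 + (k + 3) / 2) := by
          rw [← Complex.Gamma_add_one _ hne]
          congr 1
          push_cast
          ring
        have h2 : ((k : ℂ) + 1) / 2 + ((z + (k + 1 : ℕ) + 2) / 2 + 1) = z / 2 + (k + 3) := by
          push_cast
          ring
        have h3 : (2 : ℂ) ^ (z + (k + 1 : ℕ) + 2) = 2 ^ z * 2 ^ (k + 1) * 4 := by
          rw [Complex.cpow_add _ _ two_ne_zero, Complex.cpow_add _ _ two_ne_zero,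
            Complex.cpow_natCast, Complex.cpow_ofNat]
          norm_num
        have hne' : z + (k + 3) ≠ 0 := fun h => hne (by linear_combination h / 2)
        have hne'' : z + (k + 2) ≠ 0 := fun h => by
          have := congrArg Complex.re h
          simp at this
          linarith
        have h4 : z + ((k + 1 : ℕ) : ℂ) + 1 = z + (k + 2) := by push_cast; ring
        have h5 : z + ((k + 1 : ℕ) : ℂ) + 2 = z + (k + 3) := by push_cast; ring
        have h6 : z / 2 + ((k : ℂ) + 3) / 2 = (z + (k + 3)) / 2 := by ring
        rw [h1, h2, h3, h4, h5, hC, h6, div_eq_mul_inv _ (Complex.Gamma (z / 2 + (k + 3)))]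
        push_cast
        field_simp
        ring
      · simp
        positivity
      · simp
        linarith

end BallEnergy

/-! ### Finiteness, positivity and invariance of the area of the unit sphere -/

section SphereArea

open Metric
open scoped NNReal ENNReal

variable {k : ℕ}

/-- A stereographic parametrisation of the unit sphere, mapping the closed unit ball onto a closed
hemisphere. -/
noncomputable def stereographicChart (v : EuclideanSpace ℝ (Fin k)) :
    EuclideanSpace ℝ (Fin (k + 1)) :=
  consPoint ((1 - ‖v‖ ^ 2) / (1 + ‖v‖ ^ 2)) ((2 / (1 + ‖v‖ ^ 2)) • v)

theorem contDiff_stereographicChart : ContDiff ℝ 1 (stereographicChart (k := k)) := by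
  have h0 : ContDiff ℝ 1 (fun v : EuclideanSpace ℝ (Fin k) => ‖v‖ ^ 2) := contDiff_norm_sq ℝ
  have hne : ∀ v : EuclideanSpace ℝ (Fin k), 1 + ‖v‖ ^ 2 ≠ 0 := fun v => by positivity
  rw [contDiff_euclidean]
  intro i
  refine Fin.cases ?_ (fun j => ?_) i
  · exact (contDiff_const.sub h0).div (contDiff_const.add h0) hne
  · have h1 : ContDiff ℝ 1 (fun v : EuclideanSpace ℝ (Fin k) => v j) :=
      contDiff_euclidean.1 contDiff_id j
    exact (contDiff_const.div (contDiff_const.add h0) hne).mul h1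

/-- The preimage is w / (1 + t), of squared norm (1 - t) / (1 + t); this is at most 1 exactly when t
is nonnegative. -/
theorem mem_image_stereographicChart {t : ℝ} {w : EuclideanSpace ℝ (Fin k)}
    (h : ‖consPoint t w‖ = 1) (ht : 0 ≤ t) :
    consPoint t w ∈ stereographicChart '' closedBall (0 : EuclideanSpace ℝ (Fin k)) 1 := by
  have h1 : t ^ 2 + ‖w‖ ^ 2 = 1 := by rw [← norm_sq_consPoint, h, one_pow]
  have hpos : 0 < 1 + t := by linarith
  have hn : ‖(1 + t)⁻¹ • w‖ ^ 2 = (1 - t) / (1 + t) := by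
    rw [norm_smul, mul_pow, Real.norm_eq_abs, sq_abs, (by linarith : ‖w‖ ^ 2 = 1 - t ^ 2)]
    field_simp
    ring
  refine ⟨(1 + t)⁻¹ • w, ?_, ?_⟩
  · rw [mem_closedBall_zero_iff, ← sq_le_one_iff₀ (norm_nonneg _), hn, div_le_one hpos]
    linarith
  · have h2 : 1 + (1 - t) / (1 + t) = 2 / (1 + t) := by field_simp; ring
    have h3 : 1 - (1 - t) / (1 + t) = 2 * t / (1 + t) := by field_simp; ring
    rw [stereographicChart, hn, h2, h3, smul_smul]
    congr 1
    · field_simp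
    · rw [div_div_cancel₀ two_ne_zero, mul_inv_cancel₀ hpos.ne', one_smul]

/-- The sphere is covered by two opposite hemispheres, each an isometric copy of a Lipschitz image
of the compact unit ball of one dimension less. -/
theorem hausdorffMeasure_sphere_lt_top :
    μHE[k] (sphere (0 : EuclideanSpace ℝ (Fin (k + 1))) 1) < ⊤ := by
  obtain ⟨K, hK⟩ := (contDiff_stereographicChart (k := k)).contDiffOn.exists_lipschitzOnWith
    one_ne_zero (convex_closedBall 0 1) (isCompact_closedBall 0 1)
  set T := stereographicChart '' closedBall (0 : EuclideanSpace ℝ (Fin k)) 1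
  have hT : μHE[k] T < ⊤ := by
    rw [Measure.euclideanHausdorffMeasure_def, Measure.smul_apply, ENNReal.smul_def, smul_eq_mul]
    refine ENNReal.mul_lt_top ENNReal.coe_lt_top ?_
    refine (hK.hausdorffMeasure_image_le k.cast_nonneg).trans_lt ?_
    exact ENNReal.mul_lt_top (ENNReal.rpow_lt_top_of_nonneg k.cast_nonneg ENNReal.coe_ne_top)
      (isCompact_closedBall _ _).measure_lt_top
  have hT' : μHE[k] ((fun x => -x) '' T) < ⊤ := by
    rwa [(LinearIsometryEquiv.neg ℝ).isometry.euclideanHausdorffMeasure_image]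
  refine (measure_mono ?_).trans_lt ((measure_union_le T ((fun x => -x) '' T)).trans_lt
    (ENNReal.add_lt_top.2 ⟨hT, hT'⟩))
  intro x hx
  rw [mem_sphere_zero_iff_norm] at hx
  obtain ⟨t, w, rfl⟩ := exists_eq_consPoint x
  rcases le_total 0 t with ht | ht
  · exact Or.inl (mem_image_stereographicChart hx ht)
  · have hneg : -consPoint t w = consPoint (-t) (-w) := by
      have := consPoint_smul (-1) t w
      simpa using this
    refine Or.inr ⟨-consPoint t w, ?_, neg_neg _⟩
    rw [hneg]
    refine mem_image_stereographicChart ?_ (by linarith)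
    rw [← hneg, norm_neg, hx]

/-- Forgetting the first coordinate is 1-Lipschitz, so a null sphere would have a null image; but
the image contains the open unit ball of one dimension less. -/
theorem hausdorffMeasure_sphere_ne_zero :
    μHE[k] (sphere (0 : EuclideanSpace ℝ (Fin (k + 1))) 1) ≠ 0 := by
  intro h0
  rw [Measure.euclideanHausdorffMeasure_def, Measure.smul_apply, ENNReal.smul_def, smul_eq_mul,
    mul_eq_zero, ENNReal.coe_eq_zero] at h0
  replace h0 := h0.resolve_left (Measure.addHaarScalarFactor_volume_hausdorffMeasure_ne_zero k)
  let P : EuclideanSpace ℝ (Fin (k + 1)) → EuclideanSpace ℝ (Fin k) :=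
    fun x => WithLp.toLp 2 fun i => x i.succ
  have hP : ∀ t v, P (consPoint t v) = v := fun t v => rfl
  have hlip : LipschitzWith 1 P := by
    refine LipschitzWith.of_dist_le_mul fun x y => ?_
    rw [NNReal.coe_one, one_mul, EuclideanSpace.dist_eq, EuclideanSpace.dist_eq]
    refine Real.sqrt_le_sqrt ?_
    rw [Fin.sum_univ_succ]
    simp only [P]
    linarith [sq_nonneg (dist (x 0) (y 0))]
  have h1 := hlip.hausdorffMeasure_image_le (d := k) k.cast_nonneg
    (sphere (0 : EuclideanSpace ℝ (Fin (k + 1))) 1)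
  rw [h0, mul_zero, nonpos_iff_eq_zero] at h1
  have h2 : ball (0 : EuclideanSpace ℝ (Fin k)) 1 ⊆ P '' sphere 0 1 := by
    intro v hv
    rw [mem_ball_zero_iff] at hv
    refine ⟨consPoint (√(1 - ‖v‖ ^ 2)) v, ?_, hP _ _⟩
    rw [mem_sphere_zero_iff_norm, ← sq_eq_sq₀ (norm_nonneg _) zero_le_one, norm_sq_consPoint,
      Real.sq_sqrt (by nlinarith [norm_nonneg v])]
    ring
  exact (measure_ball_pos (μH[k] : Measure (EuclideanSpace ℝ (Fin k))) 0 one_pos).ne'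
    (measure_mono_null h2 h1)

instance isFiniteMeasure_sphere :
    IsFiniteMeasure (μHE[k].restrict (sphere (0 : EuclideanSpace ℝ (Fin (k + 1))) 1)) :=
  ⟨by rw [Measure.restrict_apply_univ]; exact hausdorffMeasure_sphere_lt_top⟩

theorem map_restrict_sphere (L : EuclideanSpace ℝ (Fin (k + 1)) ≃ₗᵢ[ℝ]
    EuclideanSpace ℝ (Fin (k + 1))) :
    (μHE[k].restrict (sphere (0 : EuclideanSpace ℝ (Fin (k + 1))) 1)).map L =
      μHE[k].restrict (sphere (0 : EuclideanSpace ℝ (Fin (k + 1))) 1) := by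
  have h := (L.toIsometryEquiv.measurePreserving_euclideanHausdorffMeasure k).restrict_preimage
    (s := sphere (0 : EuclideanSpace ℝ (Fin (k + 1))) 1) isClosed_sphere.measurableSet
  have hpre : L.toIsometryEquiv ⁻¹' sphere (0 : EuclideanSpace ℝ (Fin (k + 1))) 1 =
      sphere 0 1 := by
    ext x
    simp
  rw [hpre] at h
  exact h.map_eq

end SphereArea

/-! ### Distribution of directions by slicing along lines -/

section SphereLaw

open Metric
open scoped NNReal ENNReal

variable {k : ℕ}

/-- The cotangent of the polar angle as a function of the normalised height `u ∈ (0, 1)`. -/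
noncomputable def heightCot (u : ℝ) : ℝ := (1 - 2 * u) / (2 * √(u * (1 - u)))

theorem hasDerivAt_heightCot {u : ℝ} (hu : u ∈ Set.Ioo (0 : ℝ) 1) :
    HasDerivAt heightCot (-(1 / (4 * (u * (1 - u)) * √(u * (1 - u))))) u := by
  have hq : 0 < u * (1 - u) := mul_pos hu.1 (by linarith [hu.2])
  have hsq := Real.sqrt_pos.2 hq
  have h1 : HasDerivAt (fun u : ℝ => 1 - 2 * u) (-2) u := by
    simpa using ((hasDerivAt_id u).const_mul 2).const_sub 1
  have h2 : HasDerivAt (fun u : ℝ => u * (1 - u)) (1 - 2 * u) u := by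
    have := (hasDerivAt_id u).mul ((hasDerivAt_id u).const_sub 1)
    refine this.congr_deriv ?_
    simp only [id_eq]
    ring
  have h3 := h1.div ((h2.sqrt hq.ne').const_mul 2) (by positivity)
  refine h3.congr_deriv ?_
  have hss := Real.sq_sqrt hq.le
  set r := √(u * (1 - u)) with hr
  rw [← hss]
  field_simp
  rw [hss]
  ring

theorem one_add_heightCot_sq {u : ℝ} (hu : u ∈ Set.Ioo (0 : ℝ) 1) :
    1 + heightCot u ^ 2 = (1 / (2 * √(u * (1 - u)))) ^ 2 := by
  have hq : 0 < u * (1 - u) := mul_pos hu.1 (by linarith [hu.2])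
  have hsq := Real.sqrt_pos.2 hq
  rw [heightCot, div_pow, div_pow, mul_pow, Real.sq_sqrt hq.le]
  have h1 : u ≠ 0 := hu.1.ne'
  have h2 : 1 - u ≠ 0 := by linarith [hu.2]
  field_simp
  ring

/-- The cosine of the polar angle, recovered from its cotangent, is 1 - 2u, which determines u. -/
theorem injOn_heightCot : Set.InjOn heightCot (Set.Ioo 0 1) := by
  have key : ∀ u ∈ Set.Ioo (0 : ℝ) 1, heightCot u / √(1 + heightCot u ^ 2) = 1 - 2 * u := by
    intro u hu
    have hq : 0 < u * (1 - u) := mul_pos hu.1 (by linarith [hu.2])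
    have hsq := Real.sqrt_pos.2 hq
    rw [one_add_heightCot_sq hu, Real.sqrt_sq (by positivity), heightCot]
    field_simp
  intro u hu v hv h
  have h1 := key u hu
  rw [h, key v hv] at h1
  linarith

theorem surjOn_heightCot : heightCot '' Set.Ioo 0 1 = Set.univ := by
  refine Set.eq_univ_of_forall fun τ => ?_
  have hpos : 0 < 1 + τ ^ 2 := by positivity
  set N := √(1 + τ ^ 2) with hN
  have hN0 : 0 < N := Real.sqrt_pos.2 hpos
  have hN2 : N ^ 2 = 1 + τ ^ 2 := Real.sq_sqrt hpos.le
  have habs : |τ| < N := by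
    rw [hN, ← Real.sqrt_sq_eq_abs]
    exact Real.sqrt_lt_sqrt (sq_nonneg _) (by linarith)
  obtain ⟨h1, h2⟩ := abs_lt.1 habs
  have h3 : τ / N < 1 := (div_lt_one hN0).2 h2
  have h4 : -1 < τ / N := by rw [lt_div_iff₀ hN0]; linarith
  refine ⟨(1 - τ / N) / 2, ⟨by linarith, by linarith⟩, ?_⟩
  have h5 : (1 - τ / N) / 2 * (1 - (1 - τ / N) / 2) = (1 / (2 * N)) ^ 2 := by
    field_simp
    linarith
  rw [heightCot, h5, Real.sqrt_sq (by positivity)]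
  field_simp
  ring

/-- The line parallel to the axis at distance s is parametrised by the normalised height of its
direction as seen from the origin; u in (0, 1) covers it exactly once. -/
theorem lintegral_eq_lintegral_heightCot {s : ℝ} (hs : 0 < s) (F : ℝ → ℝ≥0∞) :
    ∫⁻ t, F t = ∫⁻ u in Set.Ioo (0 : ℝ) 1,
      ENNReal.ofReal (s / (4 * (u * (1 - u)) * √(u * (1 - u)))) * F (s * heightCot u) := by
  have himg : (fun u => s * heightCot u) '' Set.Ioo 0 1 = Set.univ := by
    have : (fun u => s * heightCot u) = (fun t => s * t) ∘ heightCot := rfl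
    rw [this, Set.image_comp, surjOn_heightCot, Set.image_univ,
      Set.range_eq_univ.2 (mul_left_surjective₀ hs.ne')]
  have h := lintegral_image_eq_lintegral_abs_deriv_mul measurableSet_Ioo
    (fun u hu => ((hasDerivAt_heightCot hu).const_mul s).hasDerivWithinAt)
    (fun u hu v hv huv => injOn_heightCot hu hv (mul_left_cancel₀ hs.ne' huv)) F
  rw [himg, Measure.restrict_univ] at h
  rw [h]
  refine setLIntegral_congr_fun measurableSet_Ioo fun u hu => ?_
  have hq : 0 < u * (1 - u) := mul_pos hu.1 (by linarith [hu.2])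
  congr 2
  rw [mul_neg, abs_neg, abs_of_pos (by positivity)]
  ring

theorem norm_consPoint_heightCot {v : EuclideanSpace ℝ (Fin k)} {u : ℝ}
    (hu : u ∈ Set.Ioo (0 : ℝ) 1) :
    ‖consPoint (‖v‖ * heightCot u) v‖ = ‖v‖ / (2 * √(u * (1 - u))) := by
  rw [← sq_eq_sq₀ (norm_nonneg _) (by positivity), norm_sq_consPoint, mul_pow]
  have := one_add_heightCot_sq hu
  calc ‖v‖ ^ 2 * heightCot u ^ 2 + ‖v‖ ^ 2 = ‖v‖ ^ 2 * (1 + heightCot u ^ 2) := by ring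
    _ = _ := by rw [this]; ring

/-- The direction of the point has first coordinate 1 - 2u, so its squared distance to the pole is 2
- 2(1 - 2u) = 4u. -/
theorem norm_sub_consPoint_heightCot {v : EuclideanSpace ℝ (Fin k)} (hv : v ≠ 0) {u : ℝ}
    (hu : u ∈ Set.Ioo (0 : ℝ) 1) :
    ‖consPoint 1 0 - ‖consPoint (‖v‖ * heightCot u) v‖⁻¹ • consPoint (‖v‖ * heightCot u) v‖ =
      2 * √u := by
  have hv0 : 0 < ‖v‖ := norm_pos_iff.2 hv
  have hq : 0 < u * (1 - u) := mul_pos hu.1 (by linarith [hu.2])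
  have hsq := Real.sqrt_pos.2 hq
  rw [norm_consPoint_heightCot hu, sub_eq_add_neg, ← neg_smul, consPoint_smul, consPoint_add,
    ← sq_eq_sq₀ (norm_nonneg _) (by positivity), norm_sq_consPoint, zero_add, norm_smul, mul_pow,
    mul_pow, Real.sq_sqrt hu.1.le, Real.norm_eq_abs, sq_abs]
  have h1 : 1 + -(‖v‖ / (2 * √(u * (1 - u))))⁻¹ * (‖v‖ * heightCot u) = 2 * u := by
    rw [heightCot]
    field_simp
    ring
  have h2 : (-(‖v‖ / (2 * √(u * (1 - u))))⁻¹) ^ 2 * ‖v‖ ^ 2 = 4 * (u * (1 - u)) := by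
    rw [inv_div, neg_sq, div_pow, mul_pow, Real.sq_sqrt hq.le]
    field_simp
    ring
  rw [h1, h2]
  ring

theorem lintegral_comp_norm_div {f : ℝ → ℝ≥0∞} (hf : Measurable f) {a : ℝ} (ha : 0 < a) :
    ∫⁻ v : EuclideanSpace ℝ (Fin k), f (‖v‖ / a) =
      ENNReal.ofReal (a ^ k) * ∫⁻ v : EuclideanSpace ℝ (Fin k), f ‖v‖ := by
  have h := Measure.map_addHaar_smul (volume : Measure (EuclideanSpace ℝ (Fin k)))
    (inv_ne_zero ha.ne')
  have h2 := lintegral_map (μ := (volume : Measure (EuclideanSpace ℝ (Fin k))))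
    (f := fun v => f ‖v‖) (g := fun v => a⁻¹ • v) (by fun_prop) (by fun_prop)
  rw [h, lintegral_smul_measure] at h2
  simp only [finrank_euclideanSpace, Fintype.card_fin, norm_smul, Real.norm_eq_abs, abs_inv,
    abs_of_pos ha, inv_pow, inv_inv, smul_eq_mul, abs_pow] at h2
  rw [h2]
  refine lintegral_congr fun v => ?_
  rw [div_eq_inv_mul]

/-- In the coordinates (u, v) the distance to the pole depends on u only, and the norm of y is `‖v‖
/ a` with `a = 2 * √(u * (1 - u))`. Rescaling v by a separates the variables: k + 1 powers of a come
from dv and one from the weight `‖v‖` in the Jacobian. -/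
theorem lintegral_radial_direction {φ : ℝ → ℝ≥0∞} (hφ : Measurable φ) :
    ∫⁻ y : EuclideanSpace ℝ (Fin (k + 2)), (Set.Iio (1 : ℝ)).indicator 1 ‖y‖ *
      φ ‖consPoint 1 0 - ‖y‖⁻¹ • y‖ =
    (∫⁻ v : EuclideanSpace ℝ (Fin (k + 1)), ENNReal.ofReal ‖v‖ *
      (Set.Iio (1 : ℝ)).indicator 1 ‖v‖) *
    ∫⁻ u in Set.Ioo (0 : ℝ) 1, φ (2 * √u) *
      ENNReal.ofReal ((2 * √(u * (1 - u))) ^ (k + 2) / (4 * (u * (1 - u)) * √(u * (1 - u)))) := by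
  have hg : Measurable ((Set.Iio (1 : ℝ)).indicator (1 : ℝ → ℝ≥0∞)) :=
    measurable_one.indicator measurableSet_Iio
  set g : ℝ → ℝ≥0∞ := (Set.Iio (1 : ℝ)).indicator 1
  rw [lintegral_eq_lintegral_consPoint (by fun_prop)]
  have h1 : ∀ᵐ v : EuclideanSpace ℝ (Fin (k + 1)), ∫⁻ t, g ‖consPoint t v‖ *
      φ ‖consPoint 1 0 - ‖consPoint t v‖⁻¹ • consPoint t v‖ =
      ∫⁻ u in Set.Ioo (0 : ℝ) 1, ENNReal.ofReal (‖v‖ / (4 * (u * (1 - u)) * √(u * (1 - u)))) *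
        (g (‖v‖ / (2 * √(u * (1 - u)))) * φ (2 * √u)) := by
    have hne : ∀ᵐ v : EuclideanSpace ℝ (Fin (k + 1)), v ≠ 0 := by
      rw [ae_iff]
      simp
    filter_upwards [hne] with v hv
    rw [lintegral_eq_lintegral_heightCot (norm_pos_iff.2 hv)]
    refine setLIntegral_congr_fun measurableSet_Ioo fun u hu => ?_
    rw [norm_sub_consPoint_heightCot hv hu, norm_consPoint_heightCot hu]
  rw [lintegral_congr_ae h1, lintegral_lintegral_swap (by fun_prop),
    ← lintegral_const_mul _ (by fun_prop)]
  refine setLIntegral_congr_fun measurableSet_Ioo fun u hu => ?_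
  have hq : 0 < u * (1 - u) := mul_pos hu.1 (by linarith [hu.2])
  have hsq := Real.sqrt_pos.2 hq
  have h2 : ∀ v : EuclideanSpace ℝ (Fin (k + 1)),
      ENNReal.ofReal (‖v‖ / (4 * (u * (1 - u)) * √(u * (1 - u)))) *
        (g (‖v‖ / (2 * √(u * (1 - u)))) * φ (2 * √u)) =
      (φ (2 * √u) * ENNReal.ofReal (2 * √(u * (1 - u)) / (4 * (u * (1 - u)) * √(u * (1 - u))))) *
        (ENNReal.ofReal (‖v‖ / (2 * √(u * (1 - u)))) * g (‖v‖ / (2 * √(u * (1 - u))))) := by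
    intro v
    have : ‖v‖ / (4 * (u * (1 - u)) * √(u * (1 - u))) =
        2 * √(u * (1 - u)) / (4 * (u * (1 - u)) * √(u * (1 - u))) *
          (‖v‖ / (2 * √(u * (1 - u)))) := by
      field_simp
    rw [this, ENNReal.ofReal_mul (by positivity)]
    ring
  simp only [h2]
  rw [lintegral_const_mul _ (by fun_prop),
    lintegral_comp_norm_div (f := fun r => ENNReal.ofReal r * g r) (by fun_prop)
      (by positivity : 0 < 2 * √(u * (1 - u)))]
  have h3 : (2 * √(u * (1 - u))) ^ (k + 2) / (4 * (u * (1 - u)) * √(u * (1 - u))) =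
      2 * √(u * (1 - u)) / (4 * (u * (1 - u)) * √(u * (1 - u))) *
        (2 * √(u * (1 - u))) ^ (k + 1) := by
    ring
  rw [h3, ENNReal.ofReal_mul (by positivity)]
  ring

end SphereLaw

/-! ### Continuation of the energy of the unit sphere -/

section SphereEnergy

open Metric
open scoped NNReal ENNReal

variable {k : ℕ}

theorem lintegral_dist_sphere_congr {φ : ℝ → ℝ≥0∞} (hφ : Measurable φ)
    {x x' : EuclideanSpace ℝ (Fin (k + 1))} (hx : ‖x‖ = 1) (hx' : ‖x'‖ = 1) :
    ∫⁻ y, φ ‖x - y‖ ∂(μHE[k].restrict (sphere (0 : EuclideanSpace ℝ (Fin (k + 1))) 1)) =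
      ∫⁻ y, φ ‖x' - y‖ ∂(μHE[k].restrict (sphere (0 : EuclideanSpace ℝ (Fin (k + 1))) 1)) := by
  obtain ⟨L, rfl⟩ := exists_linearIsometryEquiv_map_eq (hx.trans hx'.symm)
  conv_rhs => rw [← map_restrict_sphere L, lintegral_map (by fun_prop) (by fun_prop)]
  refine lintegral_congr fun y => ?_
  rw [← map_sub, L.norm_map]

/-- The law of the distance from a point of the unit sphere to a uniformly distributed one. -/
theorem exists_lintegral_dist_sphere (k : ℕ) : ∃ c : ℝ≥0∞, c ≠ ⊤ ∧
    ∀ x : EuclideanSpace ℝ (Fin (k + 2)), ‖x‖ = 1 → ∀ φ : ℝ → ℝ≥0∞, Measurable φ →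
      ∫⁻ y, φ ‖x - y‖ ∂(μHE[k + 1].restrict (sphere (0 : EuclideanSpace ℝ (Fin (k + 2))) 1)) =
      c * ∫⁻ u in Set.Ioo (0 : ℝ) 1, φ (2 * √u) * ENNReal.ofReal
        ((2 * √(u * (1 - u))) ^ (k + 2) / (4 * (u * (1 - u)) * √(u * (1 - u)))) := by
  have hg : Measurable ((Set.Iio (1 : ℝ)).indicator (1 : ℝ → ℝ≥0∞)) :=
    measurable_one.indicator measurableSet_Iio
  set g : ℝ → ℝ≥0∞ := (Set.Iio (1 : ℝ)).indicator 1 with hgdef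
  set μ := μHE[k + 1].restrict (sphere (0 : EuclideanSpace ℝ (Fin (k + 2))) 1) with hμ
  set G : ℝ≥0∞ := ∫⁻ y : EuclideanSpace ℝ (Fin (k + 2)), g ‖y‖ with hG
  set C : ℝ≥0∞ := ∫⁻ v : EuclideanSpace ℝ (Fin (k + 1)), ENNReal.ofReal ‖v‖ * g ‖v‖ with hC
  have hball : ∀ m : ℕ, ∫⁻ y : EuclideanSpace ℝ (Fin m), g ‖y‖ =
      volume (ball (0 : EuclideanSpace ℝ (Fin m)) 1) := by
    intro m
    rw [← lintegral_indicator_one measurableSet_ball]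
    refine lintegral_congr fun y => ?_
    classical
    simp [hgdef, Set.indicator_apply]
  have hG0 : G ≠ 0 := by
    rw [hG, hball]
    exact (measure_ball_pos _ _ one_pos).ne'
  have hGt : G ≠ ⊤ := by
    rw [hG, hball]
    exact measure_ball_lt_top.ne
  have hCt : C ≠ ⊤ := by
    refine ne_top_of_le_ne_top (b := ∫⁻ y : EuclideanSpace ℝ (Fin (k + 1)), g ‖y‖) ?_
      (lintegral_mono fun v => ?_)
    · rw [hball]
      exact measure_ball_lt_top.ne
    · by_cases hv : ‖v‖ < 1
      · have h1 : g ‖v‖ = 1 := by simp [hgdef, hv]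
        rw [h1, mul_one]
        exact ENNReal.ofReal_le_one.2 hv.le
      · simp [hgdef, hv]
  refine ⟨G⁻¹ * (μ Set.univ * C), ENNReal.mul_ne_top (ENNReal.inv_ne_top.2 hG0)
    (ENNReal.mul_ne_top (measure_ne_top _ _) hCt), fun x hx φ hφ => ?_⟩
  set K := ∫⁻ y, φ ‖x - y‖ ∂μ with hK
  have hne : ∀ᵐ y : EuclideanSpace ℝ (Fin (k + 2)), y ≠ 0 := by
    rw [ae_iff]
    simp
  -- The same double integral, over p on the sphere and y in the ball, is computed in both orders.
  -- By symmetry the integral over p does not depend on the direction of y, and the integral over y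
  -- does not depend on p. Comparison yields the law on the sphere from Lebesgue measure alone.
  have h1 : ∫⁻ y : EuclideanSpace ℝ (Fin (k + 2)), ∫⁻ p, g ‖y‖ * φ ‖p - ‖y‖⁻¹ • y‖ ∂μ =
      G * K := by
    rw [hG, ← lintegral_mul_const _ (by fun_prop)]
    refine lintegral_congr_ae ?_
    filter_upwards [hne] with y hy
    rw [lintegral_const_mul _ (by fun_prop)]
    congr 1
    have hy1 : ‖‖y‖⁻¹ • y‖ = 1 := by
      rw [norm_smul, norm_inv, norm_norm, inv_mul_cancel₀ (norm_ne_zero_iff.2 hy)]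
    rw [hK, hμ, lintegral_dist_sphere_congr hφ hx hy1]
    simp only [norm_sub_rev]
  have h2 : ∫⁻ p, (∫⁻ y : EuclideanSpace ℝ (Fin (k + 2)), g ‖y‖ * φ ‖p - ‖y‖⁻¹ • y‖) ∂μ =
      μ Set.univ * ∫⁻ y : EuclideanSpace ℝ (Fin (k + 2)), g ‖y‖ *
        φ ‖consPoint 1 0 - ‖y‖⁻¹ • y‖ := by
    rw [mul_comm, ← lintegral_const]
    refine lintegral_congr_ae ?_
    filter_upwards [ae_restrict_mem isClosed_sphere.measurableSet] with p hp
    rw [mem_sphere_zero_iff_norm] at hp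
    obtain ⟨L, rfl⟩ := exists_linearIsometryEquiv_map_eq
      (norm_consPoint_one_zero (k := k + 1) |>.trans hp.symm)
    rw [← L.measurePreserving.lintegral_comp (by fun_prop)]
    refine lintegral_congr fun y => ?_
    rw [L.norm_map, ← map_smul, ← map_sub, L.norm_map]
  rw [lintegral_lintegral_swap (by fun_prop), h2, lintegral_radial_direction hφ] at h1
  rw [mul_assoc, mul_assoc, h1, ← mul_assoc, ENNReal.inv_mul_cancel hG0 hGt, one_mul]

/-- The density simplifies to `2 ^ k` times the power (k - 1) / 2 of u(1 - u), and the kernel is `2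
^ z * u ^ (z / 2)`, which is a Beta integrand. -/
theorem integral_Ioo_sphere_density {z : ℂ} (hz : -((k : ℝ) + 1) < z.re) :
    Integrable (fun u : ℝ => ((2 * √(u * (1 - u))) ^ (k + 2) /
      (4 * (u * (1 - u)) * √(u * (1 - u)))) • ((2 * √u : ℝ) : ℂ) ^ z)
      (volume.restrict (Set.Ioo (0 : ℝ) 1)) ∧
    ∫ u in Set.Ioo (0 : ℝ) 1, ((2 * √(u * (1 - u))) ^ (k + 2) /
      (4 * (u * (1 - u)) * √(u * (1 - u)))) • ((2 * √u : ℝ) : ℂ) ^ z =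
      2 ^ k * 2 ^ z * Complex.betaIntegral (z / 2 + (k + 1) / 2) ((k + 1) / 2) := by
  have hre1 : 0 < (z / 2 + ((k : ℂ) + 1) / 2).re := by
    simp
    linarith
  have hre2 : 0 < (((k : ℂ) + 1) / 2).re := by
    simp
    positivity
  have hcongr : ∀ u ∈ Set.Ioo (0 : ℝ) 1, ((2 * √(u * (1 - u))) ^ (k + 2) /
      (4 * (u * (1 - u)) * √(u * (1 - u)))) • ((2 * √u : ℝ) : ℂ) ^ z =
      2 ^ k * 2 ^ z * ((u : ℂ) ^ (z / 2 + (k + 1) / 2 - 1) *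
        (1 - (u : ℂ)) ^ (((k : ℂ) + 1) / 2 - 1)) := by
    intro u hu
    have hu1 : 0 < 1 - u := by linarith [hu.2]
    have hq : 0 < u * (1 - u) := mul_pos hu.1 hu1
    have hsq := Real.sqrt_pos.2 hq
    have hsqu := Real.sqrt_pos.2 hu.1
    have hsqu1 := Real.sqrt_pos.2 hu1
    have h1 : (2 * √(u * (1 - u))) ^ (k + 2) / (4 * (u * (1 - u)) * √(u * (1 - u))) =
        2 ^ k * √u ^ k / √u * (√(1 - u) ^ k / √(1 - u)) := by
      rw [Real.sqrt_mul hu.1.le, mul_pow, mul_pow, pow_add, pow_add, pow_add,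
        Real.sq_sqrt hu.1.le, Real.sq_sqrt hu1.le]
      have := hu.1.ne'
      have := hu1.ne'
      field_simp
      norm_num
    have h2 : ∀ x : ℝ, 0 < x → ((√x ^ k / √x : ℝ) : ℂ) = (x : ℂ) ^ (((k : ℂ) + 1) / 2 - 1) := by
      intro x hx
      have hx0 : ((√x : ℝ) : ℂ) ≠ 0 := by exact_mod_cast (Real.sqrt_pos.2 hx).ne'
      have h3 : (((k : ℂ) + 1) / 2 - 1) = (k - 1) / 2 := by ring
      rw [h3, ← ofReal_sqrt_cpow hx, Complex.cpow_sub _ _ hx0, Complex.cpow_natCast,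
        Complex.cpow_one]
      push_cast
      rfl
    have hu0 : (u : ℂ) ≠ 0 := by exact_mod_cast hu.1.ne'
    have h4 : z / 2 + ((k : ℂ) + 1) / 2 - 1 = z / 2 + ((k + 1) / 2 - 1) := by ring
    rw [h1, Complex.real_smul, Complex.ofReal_mul 2, Complex.mul_cpow_ofReal_nonneg zero_le_two
      (Real.sqrt_nonneg _), ofReal_sqrt_cpow hu.1, h4, Complex.cpow_add _ _ hu0, ← h2 u hu.1,
      (by push_cast; ring : (1 : ℂ) - u = ((1 - u : ℝ) : ℂ)), ← h2 _ hu1]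
    push_cast
    ring
  have hconv := Complex.betaIntegral_convergent hre1 hre2
  rw [intervalIntegrable_iff_integrableOn_Ioo_of_le zero_le_one] at hconv
  constructor
  · refine (integrable_congr ?_).2 (hconv.const_mul (2 ^ k * 2 ^ z))
    filter_upwards [ae_restrict_mem measurableSet_Ioo] with u hu
    exact hcongr u hu
  · rw [setIntegral_congr_fun measurableSet_Ioo hcongr, integral_const_mul, Complex.betaIntegral,
      intervalIntegral.integral_of_le zero_le_one, integral_Ioc_eq_integral_Ioo]

theorem exists_integral_dist_sphere (k : ℕ) : ∃ c : ℝ, ∀ z : ℂ, -((k : ℝ) + 1) < z.re →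
    Integrable (fun p : EuclideanSpace ℝ (Fin (k + 2)) × EuclideanSpace ℝ (Fin (k + 2)) =>
      ((‖p.1 - p.2‖ : ℝ) : ℂ) ^ z)
      ((μHE[k + 1].restrict (sphere 0 1)).prod (μHE[k + 1].restrict (sphere 0 1))) ∧
    ∫ p : EuclideanSpace ℝ (Fin (k + 2)) × EuclideanSpace ℝ (Fin (k + 2)),
      ((‖p.1 - p.2‖ : ℝ) : ℂ) ^ z
      ∂((μHE[k + 1].restrict (sphere 0 1)).prod (μHE[k + 1].restrict (sphere 0 1))) =
    c * (2 ^ z * Complex.betaIntegral (z / 2 + (k + 1) / 2) ((k + 1) / 2)) := by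
  obtain ⟨c, hc, hlaw⟩ := exists_lintegral_dist_sphere k
  set μ := μHE[k + 1].restrict (sphere (0 : EuclideanSpace ℝ (Fin (k + 2))) 1) with hμ
  set d : ℝ → ℝ≥0∞ := fun u => c * ENNReal.ofReal
    ((2 * √(u * (1 - u))) ^ (k + 2) / (4 * (u * (1 - u)) * √(u * (1 - u)))) with hd
  have hdm : Measurable d := by fun_prop
  have hdt : ∀ u, d u < ⊤ := fun u => ENNReal.mul_lt_top hc.lt_top ENNReal.ofReal_lt_top
  have hdr : ∀ u ∈ Set.Ioo (0 : ℝ) 1, (d u).toReal = c.toReal *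
      ((2 * √(u * (1 - u))) ^ (k + 2) / (4 * (u * (1 - u)) * √(u * (1 - u)))) := by
    intro u hu
    have hq : 0 < u * (1 - u) := mul_pos hu.1 (by linarith [hu.2])
    rw [ENNReal.toReal_mul, ENNReal.toReal_ofReal (by positivity)]
  have hlaw' : ∀ x : EuclideanSpace ℝ (Fin (k + 2)), ‖x‖ = 1 → ∀ φ : ℝ → ℝ≥0∞, Measurable φ →
      ∫⁻ y, φ ‖x - y‖ ∂μ = ∫⁻ u, φ (2 * √u) ∂((volume.restrict (Set.Ioo 0 1)).withDensity d) := by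
    intro x hx φ hφ
    rw [hlaw x hx φ hφ, lintegral_withDensity_eq_lintegral_mul _ hdm (by fun_prop),
      ← lintegral_const_mul _ (by fun_prop)]
    refine lintegral_congr fun u => ?_
    simp only [hd, Pi.mul_apply]
    ring
  have hmem : ∀ᵐ x ∂μ, ‖x‖ = 1 := by
    filter_upwards [ae_restrict_mem isClosed_sphere.measurableSet] with x hx
    simpa using hx
  refine ⟨μ.real Set.univ * (c.toReal * 2 ^ k), fun z hz => ?_⟩
  have hF : Measurable (fun r : ℝ => (r : ℂ) ^ z) := Measurable.pow_const (by fun_prop) z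
  have hN : Measurable (fun r : ℝ => ((‖(r : ℂ) ^ z‖ : ℝ) : ℂ)) := by fun_prop
  have hr : Measurable (fun u : ℝ => 2 * √u) := by fun_prop
  have key := fun (x : EuclideanSpace ℝ (Fin (k + 2))) (hx : ‖x‖ = 1) =>
    integral_eq_and_integrable_iff_of_lintegral_eq (by fun_prop) hr (hlaw' x hx) hF
  have keyN := fun (x : EuclideanSpace ℝ (Fin (k + 2))) (hx : ‖x‖ = 1) =>
    (integral_eq_and_integrable_iff_of_lintegral_eq (by fun_prop) hr (hlaw' x hx) hN).1
  obtain ⟨hi, he⟩ := integral_Ioo_sphere_density (k := k) hz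
  have hcongr : (fun u => (d u).toReal • ((2 * √u : ℝ) : ℂ) ^ z) =ᵐ[volume.restrict
      (Set.Ioo (0 : ℝ) 1)] fun u => (c.toReal : ℂ) * (((2 * √(u * (1 - u))) ^ (k + 2) /
      (4 * (u * (1 - u)) * √(u * (1 - u)))) • ((2 * √u : ℝ) : ℂ) ^ z) := by
    filter_upwards [ae_restrict_mem measurableSet_Ioo] with u hu
    rw [hdr u hu, mul_smul, Complex.real_smul]
  have hslice : ∀ x : EuclideanSpace ℝ (Fin (k + 2)), ‖x‖ = 1 →
      Integrable (fun y => ((‖x - y‖ : ℝ) : ℂ) ^ z) μ := by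
    intro x hx
    rw [(key x hx).2, integrable_withDensity_iff_integrable_smul' hdm
      (Filter.Eventually.of_forall hdt), integrable_congr hcongr]
    exact hi.const_mul _
  have hint : Integrable (fun p : EuclideanSpace ℝ (Fin (k + 2)) × EuclideanSpace ℝ (Fin (k + 2)) =>
      ((‖p.1 - p.2‖ : ℝ) : ℂ) ^ z) (μ.prod μ) := by
    rw [integrable_prod_iff (measurable_riesz_kernel z).aestronglyMeasurable]
    constructor
    · filter_upwards [hmem] with x hx
      exact hslice x hx
    -- The distance law does not depend on the base point, so the absolute slice integrals are
    -- constant, hence integrable for a finite measure.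
    · have hconst : (fun x => ∫ y, ‖((‖x - y‖ : ℝ) : ℂ) ^ z‖ ∂μ) =ᵐ[μ] fun _ =>
          ∫ y, ‖((‖consPoint 1 0 - y‖ : ℝ) : ℂ) ^ z‖ ∂μ := by
        filter_upwards [hmem] with x hx
        have h1 := (keyN x hx).trans (keyN _ norm_consPoint_one_zero).symm
        rw [integral_complex_ofReal, integral_complex_ofReal] at h1
        exact_mod_cast h1
      exact (integrable_congr hconst).2 (integrable_const _)
  refine ⟨hint, ?_⟩
  rw [integral_prod _ hint]
  have hval : (fun x => ∫ y, ((‖x - y‖ : ℝ) : ℂ) ^ z ∂μ) =ᵐ[μ] fun _ => (c.toReal : ℂ) *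
      (2 ^ k * 2 ^ z * Complex.betaIntegral (z / 2 + (k + 1) / 2) ((k + 1) / 2)) := by
    filter_upwards [hmem] with x hx
    rw [(key x hx).1, integral_withDensity_eq_integral_toReal_smul hdm
      (Filter.Eventually.of_forall hdt), integral_congr_ae hcongr, integral_const_mul, he]
  rw [integral_congr_ae hval, integral_const, Complex.real_smul]
  push_cast
  ring

theorem sphere_one_eq_pair : sphere (0 : EuclideanSpace ℝ (Fin 1)) 1 =
    {consPoint 1 0, -consPoint 1 0} := by
  ext x
  rw [mem_sphere_zero_iff_norm, Set.mem_insert_iff, Set.mem_singleton_iff]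
  constructor
  · intro h
    obtain ⟨t, v, rfl⟩ := exists_eq_consPoint x
    obtain rfl : v = 0 := Subsingleton.elim _ _
    have h1 := norm_sq_consPoint (k := 0) t 0
    rw [h] at h1
    have h2 : t = 1 ∨ t = -1 := by
      exact sq_eq_one_iff.1 (by simpa using h1.symm)
    rcases h2 with rfl | rfl
    · exact Or.inl rfl
    · right
      have := consPoint_smul (k := 0) (-1) 1 0
      simpa using this.symm
  · rintro (rfl | rfl)
    · exact norm_consPoint_one_zero
    · rw [norm_neg]
      exact norm_consPoint_one_zero

theorem restrict_sphere_one : (μHE[0] : Measure (EuclideanSpace ℝ (Fin 1))).restrict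
    (sphere 0 1) = Measure.dirac (consPoint 1 0) + Measure.dirac (-consPoint 1 0) := by
  have hne : (consPoint 1 0 : EuclideanSpace ℝ (Fin 1)) ≠ -consPoint 1 0 := by
    intro h
    have := congrArg (fun x : EuclideanSpace ℝ (Fin 1) => x 0) h
    simp at this
    norm_num at this
  rw [sphere_one_eq_pair, Set.insert_eq, Measure.restrict_union (by simpa using hne)
    (measurableSet_singleton _), Measure.restrict_singleton, Measure.restrict_singleton]
  simp

theorem integral_prod_sphere_one (F : EuclideanSpace ℝ (Fin 1) × EuclideanSpace ℝ (Fin 1) → ℂ) :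
    ∫ p, F p ∂((μHE[0].restrict (sphere 0 1)).prod (μHE[0].restrict (sphere 0 1))) =
      F (consPoint 1 0, consPoint 1 0) + F (-consPoint 1 0, consPoint 1 0) +
      (F (consPoint 1 0, -consPoint 1 0) + F (-consPoint 1 0, -consPoint 1 0)) := by
  have hi : ∀ p : EuclideanSpace ℝ (Fin 1) × EuclideanSpace ℝ (Fin 1),
      Integrable F (Measure.dirac p) := fun p => integrable_dirac (by simp)
  rw [restrict_sphere_one, Measure.prod_add, Measure.add_prod, Measure.add_prod]
  simp only [Measure.dirac_prod_dirac]
  rw [integral_add_measure ((hi _).add_measure (hi _)) ((hi _).add_measure (hi _)),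
    integral_add_measure (hi _) (hi _), integral_add_measure (hi _) (hi _)]
  simp only [integral_dirac]

theorem norm_consPoint_add_self :
    ‖(consPoint 1 0 : EuclideanSpace ℝ (Fin 1)) + consPoint 1 0‖ = 2 := by
  rw [← two_smul ℝ, norm_smul, norm_consPoint_one_zero]
  norm_num

theorem exists_hasContinuation_sphere (k : ℕ) :
    ∃ A : ℂ → ℂ, HasContinuation k
      (μHE[k].restrict (sphere (0 : EuclideanSpace ℝ (Fin (k + 1))) 1)) A ∧
      ∀ z ∉ boundaryPoles (k + 1), AnalyticAt ℂ A z := by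
  have hreg : ∀ z : ℂ, -(k : ℝ) < z.re → z ∉ boundaryPoles (k + 1) := by
    rintro z hz ⟨j, rfl⟩
    have : (0 : ℝ) ≤ j := j.cast_nonneg
    simp at hz
    linarith
  rcases k with _ | k
  · have han : ∀ z, AnalyticAt ℂ (fun z : ℂ => 2 * ((2 : ℝ) : ℂ) ^ z) z :=
      fun z => analyticAt_const.mul (analyticAt_ofReal_const_cpow two_pos z)
    refine ⟨_, ⟨fun z _ => (han z).meromorphicAt, fun z _ => han z, ?_, ?_⟩, fun z _ => han z⟩
    · intro z hz
      rw [restrict_sphere_one, Measure.prod_add, Measure.add_prod, Measure.add_prod]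
      simp only [Measure.dirac_prod_dirac]
      exact ((integrable_dirac (by simp)).add_measure (integrable_dirac (by simp))).add_measure
        ((integrable_dirac (by simp)).add_measure (integrable_dirac (by simp)))
    · intro z hz
      -- The two diagonal terms `0 ^ z` vanish only because z is nonzero. At 0 the continuation
      -- takes the value 2, whereas the squared mass of the two points is 4.
      have hz0 : z ≠ 0 := fun h => by simp [h] at hz
      have h2 : ‖-(consPoint 1 0 : EuclideanSpace ℝ (Fin 1)) - consPoint 1 0‖ = 2 := by
        rw [← neg_add', norm_neg, norm_consPoint_add_self]
      rw [integral_prod_sphere_one]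
      simp only [sub_self, norm_zero, sub_neg_eq_add, norm_consPoint_add_self, h2,
        Complex.ofReal_zero, Complex.zero_cpow hz0]
      ring
  · obtain ⟨c, hc⟩ := exists_integral_dist_sphere k
    have han : ∀ z ∉ boundaryPoles (k + 1 + 1), AnalyticAt ℂ (fun z : ℂ =>
        c * Complex.Gamma ((k + 1) / 2) * ((2 : ℝ) : ℂ) ^ z *
          (Complex.Gamma (z / 2 + (k + 1) / 2) * (Complex.Gamma (z / 2 + (k + 1)))⁻¹)) z := by
      intro z hz
      -- The Gamma poles are -(k + 1) - 2j, that is -n + 1 - 2j with n = k + 2.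
      have h2 : ∀ j : ℕ, z / 2 + ((k : ℂ) + 1) / 2 ≠ -(j : ℂ) := fun j h =>
        hz ⟨j, by push_cast; linear_combination 2 * h⟩
      exact (analyticAt_const.mul (analyticAt_ofReal_const_cpow two_pos z)).mul
        ((analyticAt_Gamma_comp h2).mul (analyticAt_inv_Gamma_comp _ z))
    refine ⟨_, ⟨?_, ?_, ?_, ?_⟩, han⟩
    · intro z _
      exact (analyticAt_const.mul (analyticAt_ofReal_const_cpow two_pos z)).meromorphicAt.mul
        ((meromorphicAt_Gamma_comp _ z).mul (analyticAt_inv_Gamma_comp _ z).meromorphicAt)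
    · exact fun z hz => han z (hreg z hz)
    · exact fun z hz => (hc z (by simpa using hz)).1
    · intro z hz
      have hz' : -((k : ℝ) + 1) < z.re := by simpa using hz
      rw [(hc z hz').2, Complex.betaIntegral_eq_Gamma_mul_div]
      · have h1 : z / 2 + ((k : ℂ) + 1) / 2 + (k + 1) / 2 = z / 2 + (k + 1) := by ring
        rw [h1]
        push_cast
        ring
      · simp
        linarith
      · simp
        positivity

end SphereEnergy

/-! ### Functional independence -/

section FunctionalIndependence

open Metric Filter Topology
open scoped NNReal ENNReal

variable {n : ℕ}

/-- `F` is a `d`-dimensional energy functional on single balls and pairs of balls, built from the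
measure `μ` carried by the unit ball and the continuation `A` of its Riesz energy. -/
structure IsBallEnergy (d : ℕ) (F : Set (EuclideanSpace ℝ (Fin n)) → ℂ → ℂ)
    (μ : Measure (EuclideanSpace ℝ (Fin n))) (A : ℂ → ℂ) : Prop where
  isFiniteMeasure : IsFiniteMeasure μ
  ae_norm_le_one : ∀ᵐ x ∂μ, ‖x‖ ≤ 1
  mass_ne_zero : μ.real Set.univ ≠ 0
  hasContinuation : HasContinuation d μ A
  closedBall_eq : ∀ R : ℝ, 0 < R → ∀ w : ℂ, AnalyticAt ℂ A w →
    F (closedBall 0 R) w = ((R : ℂ) ^ d) ^ 2 * (R : ℂ) ^ w * A w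
  ballPair_eq : ∀ (R : ℝ) (c : EuclideanSpace ℝ (Fin n)), 0 < R → 2 * R < ‖c‖ → ∀ w : ℂ,
    AnalyticAt ℂ A w →
    F (ballPair R c) w = 2 * ((R : ℂ) ^ d) ^ 2 * ((R : ℂ) ^ w * A w + interaction μ R c w)

variable {μ ν : Measure (EuclideanSpace ℝ (Fin n))} {A B : ℂ → ℂ}

theorem interaction_zero [IsFiniteMeasure μ] (R : ℝ) (c : EuclideanSpace ℝ (Fin n)) :
    interaction μ R c 0 = (μ.real Set.univ : ℂ) ^ 2 := by
  simp [interaction, ← Set.univ_prod_univ, measureReal_prod_prod, sq]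

/-- Positive dimension puts 0 inside the half-plane of convergence, where the kernel is 1. For two
points with counting measure the identity fails. -/
theorem HasContinuation.apply_zero [IsFiniteMeasure μ] {m : ℕ} (h : HasContinuation m μ A)
    (hm : 0 < m) : A 0 = (μ.real Set.univ : ℂ) ^ 2 := by
  rw [h.eq_integral 0 (by simpa using hm)]
  simp [← Set.univ_prod_univ, measureReal_prod_prod, sq]

/-- Rescaling to separation 1 turns the constant into `K * R ^ w`, with R the inverse of the
separation. As R tends to 0 this tends to the mass squared, which is nonzero. -/
theorem eq_zero_of_interaction_eq_const [IsFiniteMeasure μ] (hμ : ∀ᵐ x ∂μ, ‖x‖ ≤ 1)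
    (h0 : μ.real Set.univ ≠ 0) {e : EuclideanSpace ℝ (Fin n)} (he : ‖e‖ = 1) {w K : ℂ}
    (h : ∀ d : ℝ, 2 < d → interaction μ 1 (d • e) w = K) : w = 0 := by
  have hid : Tendsto (fun R : ℝ => R) (𝓝[>] 0) (𝓝 0) := tendsto_id.mono_left nhdsWithin_le_nhds
  have h1 := tendsto_interaction hμ hid (tendsto_const_nhds (x := (1 : ℝ))) he w
  refine eq_zero_of_tendsto_cpow (K := K) (pow_ne_zero 2 (by exact_mod_cast h0)) (h1.congr' ?_)
  filter_upwards [Ioo_mem_nhdsGT (by norm_num : (0 : ℝ) < 1 / 2)] with R hR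
  have hR2 : 2 < R⁻¹ := by
    rw [lt_inv_comm₀ two_pos hR.1]
    linarith [hR.2]
  have h2 := interaction_smul (μ := μ) hR.1 1 (R⁻¹ • e) w
  rw [smul_smul, mul_inv_cancel₀ hR.1.ne', mul_one, h _ hR2] at h2
  rw [h2, mul_comm]

/-- Moving two unit balls apart keeps the mass, hence `F` at 0, and changes `G` only through the
interaction. Only `F` needs positive dimension, so the boundary energy in dimension 1 is allowed as
`G`. -/
theorem eq_zero_of_energy_determined {d d' : ℕ}
    {F G : Set (EuclideanSpace ℝ (Fin n)) → ℂ → ℂ} (hF : IsBallEnergy d F μ A)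
    (hG : IsBallEnergy d' G ν B) (hd : 0 < d) {e : EuclideanSpace ℝ (Fin n)} (he : ‖e‖ = 1) {w : ℂ}
    (hw : AnalyticAt ℂ B w)
    (h : ∀ Ω Ω' : Set (EuclideanSpace ℝ (Fin n)), IsCompactBody Ω → IsCompactBody Ω' →
      F Ω 0 = F Ω' 0 → G Ω w = G Ω' w) :
    w = 0 := by
  have := hF.isFiniteMeasure
  have := hG.isFiniteMeasure
  have hA0 := hF.hasContinuation.analyticAt 0 (by simpa using hd)
  have hnorm : ∀ a : ℝ, 2 < a → 2 * (1 : ℝ) < ‖a • e‖ := by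
    intro a ha
    rw [norm_smul, he, Real.norm_eq_abs, abs_of_pos (by linarith)]
    linarith
  refine eq_zero_of_interaction_eq_const hG.ae_norm_le_one hG.mass_ne_zero he
    (K := interaction ν 1 ((3 : ℝ) • e) w) fun a ha => ?_
  have h3 := hnorm 3 (by norm_num)
  have h1 := h _ _ (isCompactBody_ballPair one_pos (hnorm a ha))
    (isCompactBody_ballPair one_pos h3) (by
      rw [hF.ballPair_eq _ _ one_pos (hnorm a ha) 0 hA0, hF.ballPair_eq _ _ one_pos h3 0 hA0,
        interaction_zero, interaction_zero])
  rw [hG.ballPair_eq _ _ one_pos (hnorm a ha) w hw, hG.ballPair_eq _ _ one_pos h3 w hw] at h1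
  simpa using h1

/-- Once `w = 0` both values are squared masses. One ball of radius R with `R ^ d = 2` matches two
unit balls in d-dimensional mass; matching also in dimension d' would give `R ^ d' = R ^ d` with R >
1. -/
theorem not_energy_determined {d d' : ℕ}
    {F G : Set (EuclideanSpace ℝ (Fin n)) → ℂ → ℂ} (hF : IsBallEnergy d F μ A)
    (hG : IsBallEnergy d' G ν B) (hd : 0 < d) (hd' : 0 < d') (hne : d ≠ d')
    {e : EuclideanSpace ℝ (Fin n)} (he : ‖e‖ = 1) {w : ℂ} (hw : AnalyticAt ℂ B w)
    (h : ∀ Ω Ω' : Set (EuclideanSpace ℝ (Fin n)), IsCompactBody Ω → IsCompactBody Ω' →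
      F Ω 0 = F Ω' 0 → G Ω w = G Ω' w) : False := by
  obtain rfl := eq_zero_of_energy_determined hF hG hd he hw h
  have := hF.isFiniteMeasure
  have := hG.isFiniteMeasure
  have hA0 := hF.hasContinuation.analyticAt 0 (by simpa using hd)
  obtain ⟨R, hR, hRd⟩ : ∃ R : ℝ, 0 < R ∧ R ^ d = 2 :=
    ⟨2 ^ ((d : ℝ)⁻¹), by positivity, Real.rpow_inv_natCast_pow zero_le_two hd.ne'⟩
  have hR1 : 1 < R := by
    by_contra hle
    have := pow_le_one₀ (n := d) hR.le (not_lt.1 hle)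
    linarith
  have h3 : 2 * (1 : ℝ) < ‖(3 : ℝ) • e‖ := by
    rw [norm_smul, he]
    norm_num
  have h1 := h _ _ (isCompactBody_closedBall 0 hR) (isCompactBody_ballPair one_pos h3) (by
    rw [hF.closedBall_eq R hR 0 hA0, hF.ballPair_eq _ _ one_pos h3 0 hA0, interaction_zero,
      hF.hasContinuation.apply_zero hd, ← Complex.ofReal_pow, hRd]
    simp
    ring)
  rw [hG.closedBall_eq R hR 0 hw, hG.ballPair_eq _ _ one_pos h3 0 hw, interaction_zero,
    hG.hasContinuation.apply_zero hd'] at h1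
  have hm : (ν.real Set.univ : ℂ) ^ 2 ≠ 0 := pow_ne_zero 2 (by exact_mod_cast hG.mass_ne_zero)
  have h2 : ((R : ℂ) ^ d') ^ 2 = 4 := by
    refine mul_right_cancel₀ hm ?_
    rw [Complex.cpow_zero, mul_one] at h1
    rw [h1]
    simp
    ring
  have h4 : (R ^ d') ^ 2 = 2 ^ 2 := by
    have : (((R ^ d') ^ 2 : ℝ) : ℂ) = ((2 ^ 2 : ℝ) : ℂ) := by
      push_cast
      rw [h2]
      norm_num
    exact_mod_cast this
  rw [sq_eq_sq₀ (by positivity) zero_le_two, ← hRd] at h4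
  exact hne (pow_right_injective₀ hR hR1.ne' h4).symm

theorem exists_isBallEnergy_bodyEnergy (k : ℕ) : ∃ A : ℂ → ℂ,
    IsBallEnergy (k + 1) bodyEnergy
      (μHE[k + 1].restrict (closedBall (0 : EuclideanSpace ℝ (Fin (k + 1))) 1)) A ∧
      ∀ z ∉ bodyPoles (k + 1), AnalyticAt ℂ A z := by
  obtain ⟨A, hA, han⟩ := exists_hasContinuation_closedBall k
  rw [← EuclideanSpace.euclideanHausdorffMeasure_eq_volume] at hA
  have hlt : μHE[k + 1] (closedBall (0 : EuclideanSpace ℝ (Fin (k + 1))) 1) < ⊤ := by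
    rw [EuclideanSpace.euclideanHausdorffMeasure_eq_volume]
    exact measure_closedBall_lt_top
  have hpos : μHE[k + 1] (closedBall (0 : EuclideanSpace ℝ (Fin (k + 1))) 1) ≠ 0 := by
    rw [EuclideanSpace.euclideanHausdorffMeasure_eq_volume]
    exact (measure_closedBall_pos _ _ one_pos).ne'
  have hfin : IsFiniteMeasure
      (μHE[k + 1].restrict (closedBall (0 : EuclideanSpace ℝ (Fin (k + 1))) 1)) :=
    ⟨by rwa [Measure.restrict_apply_univ]⟩
  refine ⟨A, ⟨hfin, ?_, ?_, hA, ?_, ?_⟩, han⟩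
  · filter_upwards [ae_restrict_mem measurableSet_closedBall] with x hx
    simpa using hx
  · rw [Measure.real, Measure.restrict_apply_univ]
    exact (ENNReal.toReal_pos hpos hlt.ne).ne'
  · exact fun R hR w hw => bodyEnergy_closedBall hA hR hw
  · exact fun R c hR hc w hw => bodyEnergy_ballPair hA hR hc hw

theorem exists_isBallEnergy_boundaryEnergy (k : ℕ) : ∃ A : ℂ → ℂ,
    IsBallEnergy k boundaryEnergy
      (μHE[k].restrict (sphere (0 : EuclideanSpace ℝ (Fin (k + 1))) 1)) A ∧
      ∀ z ∉ boundaryPoles (k + 1), AnalyticAt ℂ A z := by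
  obtain ⟨A, hA, han⟩ := exists_hasContinuation_sphere k
  refine ⟨A, ⟨isFiniteMeasure_sphere, ?_, ?_, hA, ?_, ?_⟩, han⟩
  · filter_upwards [ae_restrict_mem isClosed_sphere.measurableSet] with x hx
    exact le_of_eq (by simpa using hx)
  · rw [Measure.real, Measure.restrict_apply_univ]
    exact (ENNReal.toReal_pos hausdorffMeasure_sphere_ne_zero
      hausdorffMeasure_sphere_lt_top.ne).ne'
  · exact fun R hR w hw => boundaryEnergy_closedBall (n := k + 1) hA hR hw
  · exact fun R c hR hc w hw => boundaryEnergy_ballPair (n := k + 1) hA hR hc hw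

/-- The four distances between endpoints of the two intervals are a, a, a + 2R and a - 2R. -/
theorem interaction_sphere_one {R a : ℝ} (hR : 0 < R) (ha : 2 * R < a) :
    interaction (μHE[0].restrict (sphere (0 : EuclideanSpace ℝ (Fin 1)) 1)) R
      (a • consPoint 1 0) 1 = 4 * a := by
  have hn : ∀ b : ℝ, ‖b • (consPoint 1 0 : EuclideanSpace ℝ (Fin 1))‖ = |b| := fun b => by
    rw [norm_smul, norm_consPoint_one_zero, mul_one, Real.norm_eq_abs]
  have h1 : R • (-(consPoint 1 0 : EuclideanSpace ℝ (Fin 1)) - consPoint 1 0) -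
      a • consPoint 1 0 = (-(2 * R + a)) • consPoint 1 0 := by module
  have h2 : R • ((consPoint 1 0 : EuclideanSpace ℝ (Fin 1)) + consPoint 1 0) -
      a • consPoint 1 0 = (-(a - 2 * R)) • consPoint 1 0 := by module
  rw [interaction, integral_prod_sphere_one]
  simp only [sub_self, smul_zero, zero_sub, norm_neg, hn, Complex.cpow_one, sub_neg_eq_add, h1, h2,
    abs_neg]
  rw [abs_of_pos (by linarith), abs_of_pos (by linarith), abs_of_pos (by linarith)]
  push_cast
  ring

theorem continuation_sphere_one {A : ℂ → ℂ} (hA : HasContinuation 0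
    (μHE[0].restrict (sphere (0 : EuclideanSpace ℝ (Fin 1)) 1)) A) : A 1 = 4 := by
  have h2 : ‖-(consPoint 1 0 : EuclideanSpace ℝ (Fin 1)) - consPoint 1 0‖ = 2 := by
    rw [← neg_add', norm_neg, norm_consPoint_add_self]
  rw [hA.eq_integral 1 (by simp), integral_prod_sphere_one]
  simp only [sub_self, norm_zero, sub_neg_eq_add, norm_consPoint_add_self, h2, Complex.cpow_one]
  norm_num

theorem not_boundaryEnergy_determines_bodyEnergy_one {w : ℂ} (hw : w ∉ bodyPoles 1)
    (h : ∀ Ω Ω' : Set (EuclideanSpace ℝ (Fin 1)), IsCompactBody Ω → IsCompactBody Ω' →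
      boundaryEnergy Ω 1 = boundaryEnergy Ω' 1 → bodyEnergy Ω w = bodyEnergy Ω' w) : False := by
  obtain ⟨A, hA, hAan⟩ := exists_isBallEnergy_bodyEnergy 0
  obtain ⟨B, hB, hBan⟩ := exists_isBallEnergy_boundaryEnergy 0
  have := hA.isFiniteMeasure
  set μ := μHE[0 + 1].restrict (closedBall (0 : EuclideanSpace ℝ (Fin (0 + 1))) 1)
  set e : EuclideanSpace ℝ (Fin 1) := consPoint 1 0
  have he : ‖e‖ = 1 := norm_consPoint_one_zero
  have hB1 : AnalyticAt ℂ B 1 := hB.hasContinuation.analyticAt 1 (by simp)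
  have hAw : AnalyticAt ℂ A w := hAan w hw
  -- Separation 1 - R keeps the boundary energy at 1 constant, namely 2(4R + 4(1 - R)) = 8; R < 1/3
  -- is exactly disjointness.
  have hc : ∀ R : ℝ, R ∈ Set.Ioo (0 : ℝ) (1 / 3) → 2 * R < ‖(1 - R) • e‖ := by
    intro R hR
    rw [norm_smul, he, Real.norm_eq_abs, abs_of_pos (by linarith [hR.2])]
    linarith [hR.2]
  have hbd : ∀ R : ℝ, R ∈ Set.Ioo (0 : ℝ) (1 / 3) →
      boundaryEnergy (ballPair R ((1 - R) • e)) 1 = 8 := by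
    intro R hR
    rw [hB.ballPair_eq R _ hR.1 (hc R hR) 1 hB1, continuation_sphere_one hB.hasContinuation,
      interaction_sphere_one hR.1 (by linarith [hR.2])]
    rw [Complex.cpow_one]
    push_cast
    ring
  have h6 : (1 / 6 : ℝ) ∈ Set.Ioo (0 : ℝ) (1 / 3) := by constructor <;> norm_num
  set K := bodyEnergy (ballPair (1 / 6) ((1 - 1 / 6 : ℝ) • e)) w
  have hK : ∀ R : ℝ, R ∈ Set.Ioo (0 : ℝ) (1 / 3) →
      2 * (R : ℂ) ^ 2 * ((R : ℂ) ^ w * A w + interaction μ R ((1 - R) • e) w) = K := by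
    intro R hR
    have := h _ _ (isCompactBody_ballPair hR.1 (hc R hR)) (isCompactBody_ballPair h6.1 (hc _ h6))
      ((hbd R hR).trans (hbd _ h6).symm)
    rw [hA.ballPair_eq R _ hR.1 (hc R hR) w hAw] at this
    refine Eq.trans ?_ this
    simp
  have hid : Tendsto (fun R : ℝ => R) (𝓝[>] 0) (𝓝 0) := tendsto_id.mono_left nhdsWithin_le_nhds
  have hsub : Tendsto (fun R : ℝ => 1 - R) (𝓝[>] 0) (𝓝 1) := by
    simpa using hid.const_sub 1
  have hL : (μ.real Set.univ : ℂ) ^ 2 ≠ 0 := pow_ne_zero 2 (by exact_mod_cast hA.mass_ne_zero)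
  -- This function is the interaction, solved for from the constancy of the body energy; its limit
  -- is the nonzero mass squared.
  have hlim : Tendsto (fun R : ℝ => K / 2 * (R : ℂ) ^ (-2 : ℂ) - A w * (R : ℂ) ^ w) (𝓝[>] 0)
      (𝓝 ((μ.real Set.univ : ℂ) ^ 2)) := by
    refine (tendsto_interaction hA.ae_norm_le_one hid hsub he w).congr' ?_
    filter_upwards [Ioo_mem_nhdsGT (by norm_num : (0 : ℝ) < 1 / 3)] with R hR
    have hR0 : (R : ℂ) ≠ 0 := by exact_mod_cast hR.1.ne'
    rw [← hK R hR, Complex.cpow_neg, Complex.cpow_ofNat]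
    field_simp
    ring
  obtain rfl := not_tendsto_cpow_neg_two_sub hL hlim
  -- With `w = 0` the second term is the constant `A 0`, itself the mass squared. So a multiple of
  -- `R ^ (-2)` would have a nonzero limit, which forces -2 = 0.
  have hlim2 := hlim.add_const (A 0)
  have h2 : (-2 : ℂ) = 0 := by
    refine eq_zero_of_tendsto_cpow (K := K / 2) (L := (μ.real Set.univ : ℂ) ^ 2 + A 0) ?_ ?_
    · rw [hA.hasContinuation.apply_zero (by norm_num), ← two_mul]
      exact mul_ne_zero two_ne_zero hL
    · simpa using hlim2
  norm_num at h2

end FunctionalIndependence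

theorem corollary3p4 (n : ℕ) (hn : 1 ≤ n) :
    (¬ ∃ (f : ℂ → ℂ) (g : {z : ℂ // z ∉ bodyPoles n} → {z : ℂ // z ∉ boundaryPoles n}),
        ∀ (z : {z : ℂ // z ∉ bodyPoles n}) (Ω : Set (EuclideanSpace ℝ (Fin n))),
          IsCompactBody Ω → f (bodyEnergy Ω z) = boundaryEnergy Ω (g z)) ∧
    (¬ ∃ (f : ℂ → ℂ) (g : {z : ℂ // z ∉ boundaryPoles n} → {z : ℂ // z ∉ bodyPoles n}),
        ∀ (z : {z : ℂ // z ∉ boundaryPoles n}) (Ω : Set (EuclideanSpace ℝ (Fin n))),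
          IsCompactBody Ω → f (boundaryEnergy Ω z) = bodyEnergy Ω (g z)) := by
  obtain ⟨k, rfl⟩ : ∃ k, n = k + 1 := ⟨n - 1, by omega⟩
  obtain ⟨A, hA, hAan⟩ := exists_isBallEnergy_bodyEnergy k
  obtain ⟨B, hB, hBan⟩ := exists_isBallEnergy_boundaryEnergy k
  have he := norm_consPoint_one_zero (k := k)
  constructor
  · rintro ⟨f, g, hfg⟩
    have h0 : (0 : ℂ) ∉ bodyPoles (k + 1) := by
      have hk : (0 : ℝ) ≤ k := k.cast_nonneg
      rintro (h | ⟨j, h⟩)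
      · have := congrArg Complex.re h
        simp at this
        linarith
      · have := congrArg Complex.re h
        have hj : (0 : ℝ) ≤ j := j.cast_nonneg
        simp at this
        linarith
    have hdet : ∀ Ω Ω' : Set (EuclideanSpace ℝ (Fin (k + 1))), IsCompactBody Ω →
        IsCompactBody Ω' → bodyEnergy Ω 0 = bodyEnergy Ω' 0 →
        boundaryEnergy Ω (g ⟨0, h0⟩) = boundaryEnergy Ω' (g ⟨0, h0⟩) := by
      intro Ω Ω' hΩ hΩ' h
      rw [← hfg ⟨0, h0⟩ Ω hΩ, ← hfg ⟨0, h0⟩ Ω' hΩ', h]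
    have hw := hBan _ (g ⟨0, h0⟩).2
    -- In dimension 1 the point 0 belongs to Q, so `g` cannot take the value 0 and the first half of
    -- the argument already suffices.
    rcases Nat.eq_zero_or_pos k with rfl | hk
    · refine (g ⟨0, h0⟩).2 ?_
      rw [eq_zero_of_energy_determined hA hB (Nat.succ_pos _) he hw hdet]
      exact ⟨0, by simp⟩
    · exact not_energy_determined hA hB (Nat.succ_pos k) hk (by omega) he hw hdet
  · rintro ⟨f, g, hfg⟩
    have hdet : ∀ (z : {z : ℂ // z ∉ boundaryPoles (k + 1)})
        (Ω Ω' : Set (EuclideanSpace ℝ (Fin (k + 1)))), IsCompactBody Ω →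
        IsCompactBody Ω' → boundaryEnergy Ω z = boundaryEnergy Ω' z →
        bodyEnergy Ω (g z) = bodyEnergy Ω' (g z) := by
      intro z Ω Ω' hΩ hΩ' h
      rw [← hfg z Ω hΩ, ← hfg z Ω' hΩ', h]
    -- In dimension 1 the point 0 is excluded from the domain of `g`, so the evaluation is made at
    -- 1.
    rcases Nat.eq_zero_or_pos k with rfl | hk
    · have h1 : (1 : ℂ) ∉ boundaryPoles (0 + 1) := by
        rintro ⟨j, h⟩
        have := congrArg Complex.re h
        have hj : (0 : ℝ) ≤ j := j.cast_nonneg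
        simp at this
        linarith
      exact not_boundaryEnergy_determines_bodyEnergy_one (g ⟨1, h1⟩).2 (hdet ⟨1, h1⟩)
    · have h0 : (0 : ℂ) ∉ boundaryPoles (k + 1) := by
        have hk' : (0 : ℝ) < k := by exact_mod_cast hk
        rintro ⟨j, h⟩
        have := congrArg Complex.re h
        have hj : (0 : ℝ) ≤ j := j.cast_nonneg
        simp at this
        linarith
      exact not_energy_determined hB hA hk (Nat.succ_pos k) (by omega) he
        (hAan _ (g ⟨0, h0⟩).2) (hdet ⟨0, h0⟩)
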